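/- **Setting.** Let $A\subset[0,\infty)$ be closed and $Q\subset[0,\infty)$ compact, with $0\in A\cap Q$, $A\setminus\{0\}\ne\emptyset$, $Q\setminus\{0\}\neq\emptyset$; let $\beta>0$; let $R:Q\to[0,\infty)$ be continuous with $R(0)=0$, and $C:A\to[0,\infty)$ continuous and non-decreasing, with $C(\alpha)/\alpha\to+\infty$ as $A\ni\alpha\to+\infty$ if $A$ is unbounded. For $x\ge 0$ an admissible strategy is a pair of Borel measurable functions $\alpha:[0,\infty)\to A$, $q:[0,\infty)\to Q$ with $X^{x,\alpha,q}_t=x+\int_0^t(\alpha_s-q_s)\,ds\ge 0$ for all $t\ge0$ ($\alpha$ locally integrable), and the *original problem* is $$v(x)=\sup_{(\alpha,q)}\int_0^\infty e^{-\beta t}(R(q_t)-C(\alpha_t))\,dt .$$ Let $\widetilde C$ be the convex hull of $C$ (extended by $+\infty$ outside $A$), $\widetilde R$ the concave hull of $R$ (extended by $-\infty$ outside $Q$), and $\mathrm{co}$ the convex hull of a set. The *convexified problem* is obtained on replacing $A,Q,R,C$ by $\mathrm{co}\,A,\mathrm{co}\,Q,\widetilde R,\widetilde C$. The *relaxed problem*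 is obtained on letting $\alpha_t(dy)$, $q_t(dy)$ be (measurable in $t$) probability measures on $A$ and $Q$, with inventory $x+\int_0^t\bigl(\int y\,\alpha_s(dy)-\int y\,q_s(dy)\bigr)ds\ge0$ and objective $\int_0^\infty e^{-\beta t}\bigl(\int R\,dq_t-\int C\,d\alpha_t\bigr)dt$. Put $\widehat R(z)=\sup_{q\in Q}\{R(q)-qz\}$, $\widehat C(z)=\sup_{\alpha\in A}\{\alpha z-C(\alpha)\}$, $H=\widehat R+\widehat C$, let $\zeta$ be the least minimum point of $H$ on $\mathbb R$, and assume $\zeta>0$. Put $\mathscr M_\zeta=\arg\max_{q\in Q}\{R(q)-\zeta q\}\cap\arg\max_{\alpha\in A}\{\alpha\zeta-C(\alpha)\}$. **Theorem.** The point $\zeta$ exists, $\widehat R,\widehat C$ are differentiable on a co-countable subset of $(0,\zeta)$, $v$ is finite and differentiable on $[0,\infty)$ (one-sidedly at $0$) with $v'>0$, and $\widetilde R-\widetilde C$ attains its maximum over $\mathrm{co}\,Q\cap\mathrm{co}\,A$. Let $F\subset(0,\zeta)$ be any co-countable set of points at which $\widehat R$ and $\widehat C$ are both differentiable. For $z\in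 F$ each of the sets $$\arg\max_{q\in \mathrm{co}\,Q}\{\widetilde R(q)-qz\}=\{\widehat q(z)\},\qquad \arg\max_{\alpha\in\mathrm{co}\,A}\{\alpha z-\widetilde C(\alpha)\}=\{\widehat\alpha(z)\}$$ is a singleton. Let $x>0$ and $\tau=\beta^{-1}\ln(v'(0)/v'(x))$. Then $\tau>0$, and the equation $v'(X_t)=v'(x)e^{\beta t}$ determines a unique $X_t\ge0$ for each $t\in[0,\tau]$; the function $X$ is strictly decreasing, with $X_0=x$, $X_\tau=0$. Put $\mathscr T=\{t\in[0,\tau]:v'(X_t)\in F\}$; the set $[0,\tau]\setminus\mathscr T$ is countable. Put $$\alpha^*_t=\widehat\alpha(v'(X_t)),\quad q^*_t=\widehat q(v'(X_t)),\quad t\in\mathscr T,\tag{1}$$ with arbitrary values in the respective control sets on $[0,\tau]\setminus\mathscr T$. These controls induce the inventory path $X$ on $[0,\tau]$. Moreover, for any $\widehat u\in\arg\max\{\widetilde R(u)-\widetilde C(u):u\in\mathrm{co}\,Q\cap\mathrm{co}\,A\}$: (i) The strategy given by (1) on $[0,\tau]$ and by $\alpha^*_t=q^*_t=\widehat u$ for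 $t>\tau$ is optimal for the convexified problem with initial inventory $x$, and its inventory is $0$ for $t\ge\tau$. (ii) For $t\in\mathscr T$ we have $\alpha^*_t\in A$, $q^*_t\in Q$, $\widetilde C(\alpha^*_t)=C(\alpha^*_t)$, $\widetilde R(q^*_t)=R(q^*_t)$. (iii) There exist $q^1,q^2\in Q$, $\alpha^1,\alpha^2\in A$, $\gamma,\nu\in(0,1)$ with $\widehat u=\gamma q^1+(1-\gamma)q^2=\nu\alpha^1+(1-\nu)\alpha^2$, $\widetilde R(\widehat u)=\gamma R(q^1)+(1-\gamma)R(q^2)$, $\widetilde C(\widehat u)=\nu C(\alpha^1)+(1-\nu)C(\alpha^2)$. For any such choice, the relaxed strategy that uses the Dirac measures at (1) for $t\in\mathscr T$ and the controls $\overline q=\gamma\delta_{q^1}+(1-\gamma)\delta_{q^2}$, $\overline\alpha=\nu\delta_{\alpha^1}+(1-\nu)\delta_{\alpha^2}$ for $t>\tau$ is optimal for the relaxed problem with initial inventory $x$. (iv) If $\mathscr M_\zeta\neq\emptyset$, then $R-C$ attains its maximum over $Q\cap A$, and for any maximiser $u$ the strategy given by (1) on $[0,\tau]$ and by $\alpha_t=q_t=u$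 for $t>\tau$ is optimal for the original problem with initial inventory $x$. -/

import Mathlib

open MeasureTheory Set Filter Topology
open scoped ENNReal

noncomputable section

/-- The set of maximisers of `f` over `S`. -/
def argmaxOn (S : Set ℝ) (f : ℝ → ℝ) : Set ℝ :=
  {y | y ∈ S ∧ ∀ w ∈ S, f w ≤ f y}

/-- The convex hull `co f` of a function `f` with domain `G`, a function on `co G`
(only its values on `convexHull ℝ G` are meaningful):
`(co f)(x) = inf {δ f(x₁) + (1-δ) f(x₂) : δ ∈ [0,1], xᵢ ∈ G, δ x₁ + (1-δ) x₂ = x}`. -/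
def convHullFun (G : Set ℝ) (f : ℝ → ℝ) (x : ℝ) : ℝ :=
  sInf {s | ∃ δ ∈ Icc (0 : ℝ) 1, ∃ x₁ ∈ G, ∃ x₂ ∈ G,
    δ * x₁ + (1 - δ) * x₂ = x ∧ s = δ * f x₁ + (1 - δ) * f x₂}

/-- The concave hull `-co(-f)`. -/
def concHullFun (G : Set ℝ) (f : ℝ → ℝ) (x : ℝ) : ℝ :=
  -convHullFun G (fun y => -f y) x

/-! ### Ordinary controls

Controls are functions of time of which only the values at times `t ≥ 0` matter.
The definitions have the control sets `A`, `Q` and the functions `R`, `C` as parameters,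
since they are used both for the original and for the convexified problem. -/

/-- The inventory level `X_t = x + ∫₀ᵗ (α_s - q_s) ds`. -/
def inventory (x : ℝ) (α q : ℝ → ℝ) (t : ℝ) : ℝ :=
  x + ∫ s in (0 : ℝ)..t, (α s - q s)

/-- Admissible strategies: Borel measurable controls `α : [0,∞) → A`, `q : [0,∞) → Q`, such that
the inventory is well defined (`α` is locally integrable; `q` will be bounded)
and stays non-negative. -/
structure Admissible (A Q : Set ℝ) (x : ℝ) (α q : ℝ → ℝ) : Prop where
  measurable_prod : Measurable (fun t : Ici (0 : ℝ) => α t)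
  measurable_sell : Measurable (fun t : Ici (0 : ℝ) => q t)
  mem_prod : ∀ t, 0 ≤ t → α t ∈ A
  mem_sell : ∀ t, 0 ≤ t → q t ∈ Q
  integrable_prod : ∀ T, 0 ≤ T → IntegrableOn α (Icc 0 T)
  inventory_nonneg : ∀ t, 0 ≤ t → 0 ≤ inventory x α q t

/-- `∫₀^∞ e^{-βt} g_t dt` for a non-negative `g`, possibly `+∞`. -/
def discounted (β : ℝ) (g : ℝ → ℝ≥0∞) : ℝ≥0∞ :=
  ∫⁻ t in Ici (0 : ℝ), ENNReal.ofReal (Real.exp (-β * t)) * g t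

/-- The discounted profit `∫₀^∞ e^{-βt} (R(q_t) - C(α_t)) dt`, for non-negative `R` and `C` with
`R` bounded: the discounted revenue is finite, the discounted cost may be `+∞`, and then the
profit is `-∞`. -/
def profit (β : ℝ) (R C : ℝ → ℝ) (α q : ℝ → ℝ) : EReal :=
  (discounted β (fun t => ENNReal.ofReal (R (q t))) : EReal) -
    (discounted β (fun t => ENNReal.ofReal (C (α t))) : EReal)

/-- The value function: supremum of the discounted profit over the admissible strategies. -/
def valueFun (β : ℝ) (A Q : Set ℝ) (R C : ℝ → ℝ) (x : ℝ) : EReal :=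
  ⨆ (α : ℝ → ℝ) (q : ℝ → ℝ) (_ : Admissible A Q x α q), profit β R C α q

/-- An optimal strategy: admissible, and its profit is the value. -/
def IsOptimal (β : ℝ) (A Q : Set ℝ) (R C : ℝ → ℝ) (x : ℝ) (α q : ℝ → ℝ) : Prop :=
  Admissible A Q x α q ∧ profit β R C α q = valueFun β A Q R C x

/-! ### Relaxed controls -/

/-- `m` is a probability measure on (the closed set) `G`. -/
def IsProbOn (G : Set ℝ) (m : Measure ℝ) : Prop :=
  IsProbabilityMeasure m ∧ m Gᶜ = 0

/-- A relaxed control with values in `G`: a map from `[0,∞)` to the probability measures on `G`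
whose integrals of bounded continuous test functions are Borel measurable in time. -/
structure IsRelaxedControl (G : Set ℝ) (m : ℝ → Measure ℝ) : Prop where
  prob : ∀ t, 0 ≤ t → IsProbOn G (m t)
  measurable : ∀ φ : ℝ → ℝ, Continuous φ → (∃ K, ∀ y, |φ y| ≤ K) →
    Measurable (fun t : Ici (0 : ℝ) => ∫ y, φ y ∂(m t))

/-- The inventory level `X_t = x + ∫₀ᵗ (∫ y α_s(dy) - ∫ y q_s(dy)) ds`. -/
def relaxedInventory (x : ℝ) (α q : ℝ → Measure ℝ) (t : ℝ) : ℝ :=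
  x + ∫ s in (0 : ℝ)..t, ((∫ y, y ∂(α s)) - ∫ y, y ∂(q s))

/-- Admissible relaxed strategies: the production up to any time is finite (so that the inventory
is well defined), and the inventory stays non-negative. -/
structure RelaxedAdmissible (A Q : Set ℝ) (x : ℝ) (α q : ℝ → Measure ℝ) : Prop where
  control_prod : IsRelaxedControl A α
  control_sell : IsRelaxedControl Q q
  finite_prod : ∀ T, 0 ≤ T → ∫⁻ t in Icc 0 T, (∫⁻ y, ENNReal.ofReal y ∂(α t)) < ⊤
  inventory_nonneg : ∀ t, 0 ≤ t → 0 ≤ relaxedInventory x α q t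

/-- The discounted profit
`∫₀^∞ e^{-βt} ∫ R(y) q_t(dy) dt - ∫₀^∞ e^{-βt} ∫ C(y) α_t(dy) dt`. -/
def relaxedProfit (β : ℝ) (R C : ℝ → ℝ) (α q : ℝ → Measure ℝ) : EReal :=
  (discounted β (fun t => ∫⁻ y, ENNReal.ofReal (R y) ∂(q t)) : EReal) -
    (discounted β (fun t => ∫⁻ y, ENNReal.ofReal (C y) ∂(α t)) : EReal)

/-- The value function of the relaxed problem. -/
def relaxedValueFun (β : ℝ) (A Q : Set ℝ) (R C : ℝ → ℝ) (x : ℝ) : EReal :=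
  ⨆ (α : ℝ → Measure ℝ) (q : ℝ → Measure ℝ) (_ : RelaxedAdmissible A Q x α q),
    relaxedProfit β R C α q

/-- An optimal relaxed strategy. -/
def IsRelaxedOptimal (β : ℝ) (A Q : Set ℝ) (R C : ℝ → ℝ) (x : ℝ)
    (α q : ℝ → Measure ℝ) : Prop :=
  RelaxedAdmissible A Q x α q ∧ relaxedProfit β R C α q = relaxedValueFun β A Q R C x

/-- The two-point distribution `p δ_a + (1-p) δ_b`. -/
def twoPoint (p a b : ℝ) : Measure ℝ :=
  ENNReal.ofReal p • Measure.dirac a + ENNReal.ofReal (1 - p) • Measure.dirac b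

/-! ### The firm -/

/-- The data of the model and its standing assumptions: sets `A`, `Q` of production and demand
rates, revenue `R` on `Q`, production cost `C` on `A`, discounting factor `β`. The values of `R`
and `C` outside `Q` and `A` play no role. -/
structure Firm where
  A : Set ℝ
  Q : Set ℝ
  R : ℝ → ℝ
  C : ℝ → ℝ
  β : ℝ
  β_pos : 0 < β
  A_closed : IsClosed A
  Q_compact : IsCompact Q
  A_nonneg : ∀ a ∈ A, 0 ≤ a
  Q_nonneg : ∀ q ∈ Q, 0 ≤ q
  zero_mem_A : (0 : ℝ) ∈ A
  zero_mem_Q : (0 : ℝ) ∈ Q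
  A_nontrivial : (A \ {0}).Nonempty
  Q_nontrivial : (Q \ {0}).Nonempty
  R_cont : ContinuousOn R Q
  R_nonneg : ∀ q ∈ Q, 0 ≤ R q
  R_zero : R 0 = 0
  C_cont : ContinuousOn C A
  C_nonneg : ∀ a ∈ A, 0 ≤ C a
  C_mono : MonotoneOn C A
  C_coercive : ¬ Bornology.IsBounded A → Tendsto (fun a => C a / a) (atTop ⊓ 𝓟 A) atTop

namespace Firm

variable (M : Firm)

/-- `R̂(z) = sup_{q ∈ Q} (R(q) - q z)`. -/
def Rhat (z : ℝ) : ℝ := sSup ((fun q => M.R q - q * z) '' M.Q)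

/-- `Ĉ(z) = sup_{α ∈ A} (α z - C(α))`. -/
def Chat (z : ℝ) : ℝ := sSup ((fun a => a * z - M.C a) '' M.A)

/-- The Hamiltonian. -/
def H (z : ℝ) : ℝ := M.Rhat z + M.Chat z

/-- The set of minimum points of the Hamiltonian. -/
def minPoints : Set ℝ := {z | ∀ w, M.H z ≤ M.H w}

/-- The least minimum point of the Hamiltonian. -/
def zeta : ℝ := sInf M.minPoints

/-- `co A`. -/
def coA : Set ℝ := convexHull ℝ M.A

/-- `co Q`. -/
def coQ : Set ℝ := convexHull ℝ M.Q

/-- The concave hull of the revenue. -/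
def Rtilde : ℝ → ℝ := concHullFun M.Q M.R

/-- The convex hull of the cost. -/
def Ctilde : ℝ → ℝ := convHullFun M.A M.C

/-- The value function of the original problem, as an extended real. -/
def value (x : ℝ) : EReal := valueFun M.β M.A M.Q M.R M.C x

/-- The value function of the original problem, as a real number. -/
def v (x : ℝ) : ℝ := (M.value x).toReal

/-- The derivative of `v` on `[0,∞)`; at `0` this is the right derivative. -/
def dv (x : ℝ) : ℝ := derivWithin M.v (Ici 0) x

/-- `τ = β⁻¹ ln (v'(0) / v'(x))`. -/
def tau (x : ℝ) : ℝ := 1 / M.β * Real.log (M.dv 0 / M.dv x)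

/-- The times `t ∈ [0,τ]` with `v'(X_t) ∈ F`. -/
def regularTimes (F : Set ℝ) (x : ℝ) (X : ℝ → ℝ) : Set ℝ :=
  {t | t ∈ Icc 0 (M.tau x) ∧ M.dv (X t) ∈ F}

/-- Demand rates that maximise `R̃(q) - q z` over `co Q`. -/
def optSell (z : ℝ) : Set ℝ := argmaxOn M.coQ (fun q => M.Rtilde q - q * z)

/-- Production rates that maximise `α z - C̃(α)` over `co A`. -/
def optProd (z : ℝ) : Set ℝ := argmaxOn M.coA (fun a => a * z - M.Ctilde a)

/-- Static maximisers for the convexified problem. -/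
def optStaticConv : Set ℝ := argmaxOn (M.coQ ∩ M.coA) (fun u => M.Rtilde u - M.Ctilde u)

/-- Static maximisers for the original problem. -/
def optStatic : Set ℝ := argmaxOn (M.Q ∩ M.A) (fun u => M.R u - M.C u)

/-- The set of rates that are optimal for both departments at the shadow price `η`. -/
def sharedOpt (η : ℝ) : Set ℝ :=
  argmaxOn M.Q (fun q => M.R q - η * q) ∩ argmaxOn M.A (fun a => a * η - M.C a)

end Firm

end

/-!
The proof is by Lagrangian duality for the constraint that the inventory is non-negative. For
`τ ≥ 0` let the shadow price be `p_t = ζ e^{-β (τ - t)⁺}`, so that the multiplier `e^{-βt} p_t` is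
positive, constant up to `τ` and decreasing afterwards. For every strategy the running profit is
at most `H(p_t) - p_t (α_t - q_t)`, and integration by parts of `e^{-βt} p_t (α_t - q_t)` against
the non-negative inventory bounds the total profit by the dual objective
`D(τ, x) = ζ e^{-βτ} x + ∫ e^{-βt} H(p_t) dt` (`Firm.discounted_sub_le_dualValue`). Only the mean
rates of production and sales enter, so the bound is the same for ordinary, convexified and relaxed
strategies. It is attained by a strategy that uses optimal rates at the price `p_t` for almost
every `t` and holds no inventory after `τ`, and it is attained up to `ζ ε` if the inventory stays
below `ε` after `τ` (`Firm.dualValue_sub_le_discounted_sub`).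

Where `R̂` and `Ĉ` are differentiable, the optimal rates at a price are unique, are given by the
derivatives, and belong to the original control sets (`Firm.optimal_rates`); their difference is
`H'(p_t) < 0`. So the feedback strategy sells out at time `τ` exactly the inventory
`Φ(τ) = -∫₀^τ H'(ζ e^{-βs}) ds` (`Firm.drain`), and `Φ` is an increasing bijection of `[0,∞)`. After
`τ` the zero inventory is maintained at a rate `u` that is optimal for both departments at the price
`ζ`; such a rate exists in the convexified problem by the sum rule for subdifferentials at the
minimum point `ζ` of `H`, and it is a combination of maximisers in `Q` and in `A`. In the original
problem `u` is imitated by alternating quickly between these maximisers, with the large production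
rate and the small sales rate first in each period.

Hence `v(Φ(τ)) = D(τ, Φ(τ))`, whereas `v(y) ≤ D(τ, y)` for all `τ`, `y ≥ 0`. Since `D(τ, ·)` is
affine with slope `ζ e^{-βτ}`, the function `v` has at `Φ(τ)` this supergradient, which depends
continuously on the inventory, so that `v'(Φ(τ)) = ζ e^{-βτ}` (`Firm.hasDerivWithinAt_v`). In
particular the equation `v'(X_t) = v'(x) e^{βt}` says that `X_t = Φ(τ - t)`, where `x = Φ(τ)`.
-/

/-! ### Convex functions on the line -/

/-- `u` is a subgradient of `φ` at `z`. -/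
def IsSubgradientAt (φ : ℝ → ℝ) (z u : ℝ) : Prop :=
  ∀ w, φ z + u * (w - z) ≤ φ w

theorem IsSubgradientAt.eq_deriv {φ : ℝ → ℝ} {z u : ℝ} (h : IsSubgradientAt φ z u)
    (hd : DifferentiableAt ℝ φ z) : u = deriv φ z := by
  have hmin : IsLocalMin (fun w => φ w - u * w) z := by
    refine Filter.Eventually.of_forall fun w => ?_
    have := h w
    show φ z - u * z ≤ φ w - u * w
    linarith
  have hder : HasDerivAt (fun w => φ w - u * w) (deriv φ z - u * 1) z :=
    hd.hasDerivAt.sub ((hasDerivAt_id z).const_mul u)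
  have := hmin.hasDerivAt_eq_zero hder
  linarith

theorem IsSubgradientAt.of_leftDeriv_le_of_le_rightDeriv {φ : ℝ → ℝ} {z u : ℝ}
    (hφ : ConvexOn ℝ univ φ) (hl : derivWithin φ (Iio z) z ≤ u)
    (hr : u ≤ derivWithin φ (Ioi z) z) : IsSubgradientAt φ z u := by
  intro w
  have hz : z ∈ interior (univ : Set ℝ) := by simp
  rcases lt_trichotomy z w with h | h | h
  · have := hr.trans (hφ.rightDeriv_le_slope_of_mem_interior hz (mem_univ w) h)
    rw [slope_def_field, le_div_iff₀ (by linarith)] at this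
    linarith
  · simp [h]
  · have := (hφ.slope_le_leftDeriv_of_mem_interior (mem_univ w) hz h).trans hl
    rw [slope_def_field, div_le_iff₀ (by linarith)] at this
    linarith

/-- A convex function is differentiable where its right derivative, which is monotone, is
continuous. -/
theorem ConvexOn.countable_not_differentiableAt {φ : ℝ → ℝ} (hφ : ConvexOn ℝ univ φ) :
    {z | ¬ DifferentiableAt ℝ φ z}.Countable := by
  have hi : ∀ z : ℝ, z ∈ interior (univ : Set ℝ) := by simp
  have hmono : Monotone (fun x => derivWithin φ (Ioi x) x) := by
    intro x y hxy
    exact hφ.monotoneOn_rightDeriv (hi x) (hi y) hxy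
  refine hmono.countable_not_continuousAt.mono ?_
  intro z hz hc
  refine hz ?_
  have hle : derivWithin φ (Ioi z) z ≤ derivWithin φ (Iio z) z := by
    refine le_of_tendsto (hc.tendsto.mono_left (nhdsWithin_le_nhds (s := Iio z))) ?_
    filter_upwards [self_mem_nhdsWithin] with w hw
    exact (hφ.rightDeriv_le_slope_of_mem_interior (hi w) (mem_univ z) hw).trans
      (hφ.slope_le_leftDeriv_of_mem_interior (mem_univ w) (hi z) hw)
  have heq := le_antisymm hle (hφ.leftDeriv_le_rightDeriv_of_mem_interior (hi z))
  have h1 := (hφ.hasDerivWithinAt_rightDeriv_of_mem_interior (hi z)).Ici_of_Ioi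
  have h2 := (hφ.hasDerivWithinAt_leftDeriv_of_mem_interior (hi z)).Iic_of_Iio
  rw [← heq] at h2
  have h3 := h2.union h1
  rw [Iic_union_Ici, hasDerivWithinAt_univ] at h3
  exact h3.differentiableAt

/-- The sum rule for subdifferentials at a minimum point. -/
theorem ConvexOn.exists_isSubgradientAt_neg {φ ψ : ℝ → ℝ} {z : ℝ} (hφ : ConvexOn ℝ univ φ)
    (hψ : ConvexOn ℝ univ ψ) (hmin : ∀ w, φ z + ψ z ≤ φ w + ψ w) :
    ∃ u, IsSubgradientAt φ z u ∧ IsSubgradientAt ψ z (-u) := by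
  have hz : z ∈ interior (univ : Set ℝ) := by simp
  have l1 := hφ.hasDerivWithinAt_leftDeriv_of_mem_interior hz
  have l2 := hψ.hasDerivWithinAt_leftDeriv_of_mem_interior hz
  have r1 := hφ.hasDerivWithinAt_rightDeriv_of_mem_interior hz
  have r2 := hψ.hasDerivWithinAt_rightDeriv_of_mem_interior hz
  have o1 := hφ.leftDeriv_le_rightDeriv_of_mem_interior hz
  have o2 := hψ.leftDeriv_le_rightDeriv_of_mem_interior hz
  set a := derivWithin φ (Iio z) z
  set b := derivWithin φ (Ioi z) z
  set c := derivWithin ψ (Iio z) z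
  set d := derivWithin ψ (Ioi z) z
  have hl : a + c ≤ 0 := by
    have h := (hasDerivWithinAt_iff_tendsto_slope' (by simp)).1 (l1.add l2)
    refine le_of_tendsto h ?_
    filter_upwards [self_mem_nhdsWithin] with w hw
    rw [slope_def_field]
    have := hmin w
    exact div_nonpos_of_nonneg_of_nonpos (by simpa using this) (by simpa using le_of_lt hw)
  have hr : 0 ≤ b + d := by
    have h := (hasDerivWithinAt_iff_tendsto_slope' (by simp)).1 (r1.add r2)
    refine ge_of_tendsto h ?_
    filter_upwards [self_mem_nhdsWithin] with w hw
    rw [slope_def_field]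
    have := hmin w
    exact div_nonneg (by simpa using this) (by simpa using le_of_lt hw)
  refine ⟨max a (-d), .of_leftDeriv_le_of_le_rightDeriv hφ (le_max_left _ _)
    (max_le o1 (by linarith)), .of_leftDeriv_le_of_le_rightDeriv hψ ?_ ?_⟩
  · have : max a (-d) ≤ -c := max_le (by linarith) (by linarith)
    show c ≤ _
    linarith
  · have : -d ≤ max a (-d) := le_max_right _ _
    show _ ≤ d
    linarith

/-! ### The Legendre–Fenchel conjugate of a coercive function on a closed set of rates -/

/-- The conjugate `z ↦ sup_{a ∈ G} (a z - f(a))` of `f` with domain `G`. -/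
noncomputable def conjOn (G : Set ℝ) (f : ℝ → ℝ) (z : ℝ) : ℝ :=
  sSup ((fun a => a * z - f a) '' G)

/-- `f` is a continuous function on the closed set `G ⊆ [0,∞)` containing `0`, and it grows faster
than any linear function. -/
structure IsSuperlinearOn (G : Set ℝ) (f : ℝ → ℝ) : Prop where
  isClosed : IsClosed G
  nonneg : ∀ a ∈ G, 0 ≤ a
  zero_mem : (0 : ℝ) ∈ G
  continuousOn : ContinuousOn f G
  bound : ∀ z, ∃ B, ∀ a ∈ G, a * z - f a ≤ B

namespace IsSuperlinearOn

variable {G : Set ℝ} {f : ℝ → ℝ}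

theorem bddAbove (h : IsSuperlinearOn G f) (z : ℝ) :
    BddAbove ((fun a => a * z - f a) '' G) := by
  obtain ⟨B, hB⟩ := h.bound z
  exact ⟨B, by rintro _ ⟨a, ha, rfl⟩; exact hB a ha⟩

theorem le_conjOn (h : IsSuperlinearOn G f) {a : ℝ} (ha : a ∈ G) (z : ℝ) :
    a * z - f a ≤ conjOn G f z :=
  le_csSup (h.bddAbove z) ⟨a, ha, rfl⟩

theorem neg_le_conjOn (h : IsSuperlinearOn G f) (z : ℝ) : -f 0 ≤ conjOn G f z := by
  simpa using h.le_conjOn h.zero_mem z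

theorem exists_eq_conjOn (h : IsSuperlinearOn G f) (z : ℝ) :
    ∃ a ∈ G, a * z - f a = conjOn G f z := by
  obtain ⟨B, hB⟩ := h.bound (z + 1)
  set K := max 0 (B + f 0) with hK
  have hcomp : IsCompact (G ∩ Icc 0 K) := isCompact_Icc.inter_left h.isClosed
  obtain ⟨a, ⟨haG, haK⟩, hmax⟩ := hcomp.exists_isMaxOn
    ⟨0, h.zero_mem, le_refl _, le_max_left _ _⟩
    (f := fun a => a * z - f a)
    ((continuousOn_id.mul continuousOn_const).sub (h.continuousOn.mono inter_subset_left))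
  refine ⟨a, haG, le_antisymm (h.le_conjOn haG z)
    (csSup_le (Set.Nonempty.image _ ⟨0, h.zero_mem⟩) ?_)⟩
  rintro _ ⟨b, hb, rfl⟩
  by_cases hbK : b ≤ K
  · exact hmax ⟨hb, h.nonneg b hb, hbK⟩
  · -- rates above `K` are worse than the rate `0`
    have h0 : (0 : ℝ) * z - f 0 ≤ a * z - f a :=
      hmax ⟨h.zero_mem, le_refl _, le_max_left _ _⟩
    have h1 := hB b hb
    have h2 : B + f 0 ≤ K := le_max_right _ _
    show b * z - f b ≤ a * z - f a
    nlinarith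

theorem isSubgradientAt (h : IsSuperlinearOn G f) {a z : ℝ} (ha : a ∈ G)
    (he : a * z - f a = conjOn G f z) : IsSubgradientAt (conjOn G f) z a := by
  intro w
  have := h.le_conjOn ha w
  rw [← he]
  linarith

theorem convexOn_conjOn (h : IsSuperlinearOn G f) : ConvexOn ℝ univ (conjOn G f) := by
  refine ⟨convex_univ, fun x _ y _ a b ha hb hab => ?_⟩
  obtain ⟨c, hc, he⟩ := h.exists_eq_conjOn (a • x + b • y)
  rw [← he]
  have h1 := mul_le_mul_of_nonneg_left (h.le_conjOn hc x) ha
  have h2 := mul_le_mul_of_nonneg_left (h.le_conjOn hc y) hb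
  simp only [smul_eq_mul]
  have : f c = a * f c + b * f c := by rw [← add_mul, hab, one_mul]
  nlinarith

theorem continuous_conjOn (h : IsSuperlinearOn G f) : Continuous (conjOn G f) :=
  h.convexOn_conjOn.locallyLipschitz.continuous

/-- A subgradient at `z` is bounded by the growth of the conjugate to the right of `z`. -/
theorem subgradient_le (h : IsSuperlinearOn G f) {z w u : ℝ}
    (hu : IsSubgradientAt (conjOn G f) z u) (hw : z + 1 ≤ w) (hu0 : 0 ≤ u) :
    u ≤ conjOn G f w + f 0 := by
  have h1 := hu w
  have h2 := h.neg_le_conjOn z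
  nlinarith

/-- Limits of maximisers are maximisers. -/
theorem exists_tendsto_subseq (h : IsSuperlinearOn G f) {z : ℝ} {s a : ℕ → ℝ}
    (hs : Tendsto s atTop (𝓝 z)) (hsz : ∀ n, s n ≤ z + 1) (ha : ∀ n, a n ∈ G)
    (he : ∀ n, a n * s n - f (a n) = conjOn G f (s n)) :
    ∃ b ∈ G, b * z - f b = conjOn G f z ∧
      ∃ k : ℕ → ℕ, StrictMono k ∧ Tendsto (a ∘ k) atTop (𝓝 b) := by
  have hcomp : IsCompact (G ∩ Icc 0 (conjOn G f (z + 2) + f 0)) :=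
    isCompact_Icc.inter_left h.isClosed
  have hmem : ∀ n, a n ∈ G ∩ Icc 0 (conjOn G f (z + 2) + f 0) := fun n =>
    ⟨ha n, h.nonneg _ (ha n), h.subgradient_le (h.isSubgradientAt (ha n) (he n))
      (by linarith [hsz n]) (h.nonneg _ (ha n))⟩
  obtain ⟨b, hb, k, hk, hlim⟩ := hcomp.tendsto_subseq hmem
  refine ⟨b, hb.1, ?_, k, hk, hlim⟩
  have hsk : Tendsto (s ∘ k) atTop (𝓝 z) := hs.comp hk.tendsto_atTop
  have h1 : Tendsto (fun n => (a ∘ k) n * (s ∘ k) n - f ((a ∘ k) n)) atTop (𝓝 (b * z - f b)) := by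
    refine (hlim.mul hsk).sub ?_
    refine (h.continuousOn b hb.1).tendsto.comp
      (tendsto_nhdsWithin_iff.2 ⟨hlim, Eventually.of_forall fun n => ha (k n)⟩)
  have h2 : Tendsto (fun n => conjOn G f ((s ∘ k) n)) atTop (𝓝 (conjOn G f z)) :=
    (h.continuous_conjOn.tendsto z).comp hsk
  refine tendsto_nhds_unique h1 (h2.congr fun n => ?_)
  exact (he (k n)).symm

/-- A subgradient of the conjugate lies between two maximisers: approximate `z` from either
side. -/
theorem exists_le_le_of_isSubgradientAt (h : IsSuperlinearOn G f) {z u : ℝ}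
    (hu : IsSubgradientAt (conjOn G f) z u) :
    ∃ a ∈ G, ∃ b ∈ G, a * z - f a = conjOn G f z ∧ b * z - f b = conjOn G f z ∧
      a ≤ u ∧ u ≤ b := by
  have hlim : Tendsto (fun n : ℕ => (1 : ℝ) / (n + 1)) atTop (𝓝 0) :=
    tendsto_one_div_add_atTop_nhds_zero_nat
  have hpos : ∀ n : ℕ, (0 : ℝ) < 1 / (n + 1) := fun n => by positivity
  have hle : ∀ n : ℕ, (1 : ℝ) / (n + 1) ≤ 1 := fun n => by
    rw [div_le_one (by positivity)]; linarith [(n.cast_nonneg : (0 : ℝ) ≤ n)]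
  choose m hm hme using h.exists_eq_conjOn
  have key : ∀ w, (w - z) * (u - m w) ≤ 0 := fun w => by
    have h1 := hu w
    have h2 := h.isSubgradientAt (hm w) (hme w) z
    nlinarith
  obtain ⟨a, ha, hae, k, -, hk⟩ := h.exists_tendsto_subseq (z := z)
    (s := fun n : ℕ => z - 1 / (n + 1)) (a := fun n : ℕ => m (z - 1 / (n + 1)))
    (by simpa using hlim.const_sub z) (fun n => by linarith [hpos n]) (fun n => hm _)
    (fun n => hme _)
  obtain ⟨b, hb, hbe, l, -, hl⟩ := h.exists_tendsto_subseq (z := z)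
    (s := fun n : ℕ => z + 1 / (n + 1)) (a := fun n : ℕ => m (z + 1 / (n + 1)))
    (by simpa using hlim.const_add z) (fun n => by linarith [hle n]) (fun n => hm _)
    (fun n => hme _)
  refine ⟨a, ha, b, hb, hae, hbe, le_of_tendsto' hk fun n => ?_, ge_of_tendsto' hl fun n => ?_⟩
  · have h1 := key (z - 1 / ((k n : ℕ) + 1))
    have h2 := hpos (k n)
    show m (z - 1 / ((k n : ℕ) + 1)) ≤ u
    nlinarith
  · have h1 := key (z + 1 / ((l n : ℕ) + 1))
    have h2 := hpos (l n)
    show u ≤ m (z + 1 / ((l n : ℕ) + 1))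
    nlinarith

end IsSuperlinearOn

/-! ### The convex hull of a function -/

theorem exists_le_le_of_mem_convexHull {G : Set ℝ} {u : ℝ} (hu : u ∈ convexHull ℝ G) :
    ∃ a ∈ G, ∃ b ∈ G, a ≤ u ∧ u ≤ b := by
  have hconv : OrdConnected {u : ℝ | ∃ a ∈ G, ∃ b ∈ G, a ≤ u ∧ u ≤ b} := by
    refine ⟨?_⟩
    rintro x ⟨a, ha, -, -, hax, -⟩ y ⟨-, -, b, hb, -, hyb⟩ w ⟨hxw, hwy⟩
    exact ⟨a, ha, b, hb, hax.trans hxw, hwy.trans hyb⟩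
  refine convexHull_min ?_ hconv.convex hu
  exact fun a ha => ⟨a, ha, a, ha, le_rfl, le_rfl⟩

theorem exists_weight_of_le_of_le {a b u : ℝ} (ha : a ≤ u) (hb : u ≤ b) :
    ∃ δ ∈ Icc (0 : ℝ) 1, δ * a + (1 - δ) * b = u := by
  rcases eq_or_lt_of_le (ha.trans hb) with hab | hab
  · exact ⟨1, by simp, by linarith⟩
  · refine ⟨(b - u) / (b - a), ⟨div_nonneg (by linarith) (by linarith), ?_⟩, ?_⟩
    · rw [div_le_one (by linarith)]; linarith
    · have : b - a ≠ 0 := by linarith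
      field_simp
      ring

theorem combo_mem_convexHull {G : Set ℝ} {a b δ : ℝ} (ha : a ∈ G) (hb : b ∈ G)
    (hδ : δ ∈ Icc (0 : ℝ) 1) : δ * a + (1 - δ) * b ∈ convexHull ℝ G :=
  (convex_convexHull ℝ G) (subset_convexHull ℝ G ha) (subset_convexHull ℝ G hb) hδ.1
    (by linarith [hδ.2]) (by ring)

namespace IsSuperlinearOn

variable {G : Set ℝ} {f : ℝ → ℝ}

theorem mul_sub_le_of_combo (h : IsSuperlinearOn G f) (z : ℝ) {u s : ℝ}
    (hs : ∃ δ ∈ Icc (0 : ℝ) 1, ∃ x₁ ∈ G, ∃ x₂ ∈ G,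
      δ * x₁ + (1 - δ) * x₂ = u ∧ s = δ * f x₁ + (1 - δ) * f x₂) :
    u * z - conjOn G f z ≤ s := by
  obtain ⟨δ, hδ, x₁, h₁, x₂, h₂, rfl, rfl⟩ := hs
  have e₁ := mul_le_mul_of_nonneg_left (h.le_conjOn h₁ z) hδ.1
  have e₂ := mul_le_mul_of_nonneg_left (h.le_conjOn h₂ z) (sub_nonneg.2 hδ.2)
  nlinarith

theorem mul_sub_convHullFun_le (h : IsSuperlinearOn G f) {u : ℝ} (hu : u ∈ convexHull ℝ G)
    (z : ℝ) : u * z - convHullFun G f u ≤ conjOn G f z := by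
  have : u * z - conjOn G f z ≤ convHullFun G f u := by
    obtain ⟨a, ha, b, hb, hau, hub⟩ := exists_le_le_of_mem_convexHull hu
    obtain ⟨δ, hδ, he⟩ := exists_weight_of_le_of_le hau hub
    exact le_csInf ⟨_, δ, hδ, a, ha, b, hb, he, rfl⟩ fun s hs => h.mul_sub_le_of_combo z hs
  linarith

theorem convHullFun_le_combo (h : IsSuperlinearOn G f) {a b δ : ℝ} (ha : a ∈ G) (hb : b ∈ G)
    (hδ : δ ∈ Icc (0 : ℝ) 1) :
    convHullFun G f (δ * a + (1 - δ) * b) ≤ δ * f a + (1 - δ) * f b :=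
  csInf_le ⟨_, fun _ hs => h.mul_sub_le_of_combo 0 hs⟩ ⟨δ, hδ, a, ha, b, hb, rfl, rfl⟩

theorem convHullFun_le (h : IsSuperlinearOn G f) {a : ℝ} (ha : a ∈ G) :
    convHullFun G f a ≤ f a := by
  simpa using h.convHullFun_le_combo ha ha (δ := 1) (by simp)

theorem isSubgradientAt_of_convHullFun (h : IsSuperlinearOn G f) {u z : ℝ}
    (hu : u ∈ convexHull ℝ G) (he : u * z - convHullFun G f u = conjOn G f z) :
    IsSubgradientAt (conjOn G f) z u := by
  intro w
  have := h.mul_sub_convHullFun_le hu w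
  rw [← he]
  linarith

/-- A subgradient of the conjugate is a convex combination of two maximisers. -/
theorem exists_combo_of_isSubgradientAt (h : IsSuperlinearOn G f) {z u : ℝ}
    (hu : IsSubgradientAt (conjOn G f) z u) :
    ∃ a ∈ G, ∃ b ∈ G, ∃ δ ∈ Ioo (0 : ℝ) 1, a ≤ b ∧
      a * z - f a = conjOn G f z ∧ b * z - f b = conjOn G f z ∧ u = δ * a + (1 - δ) * b := by
  obtain ⟨a, ha, b, hb, hae, hbe, hau, hub⟩ := h.exists_le_le_of_isSubgradientAt hu
  have half : (1 / 2 : ℝ) ∈ Ioo (0 : ℝ) 1 := by constructor <;> norm_num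
  rcases eq_or_lt_of_le hau with rfl | hau
  · exact ⟨a, ha, a, ha, 1 / 2, half, le_rfl, hae, hae, by ring⟩
  rcases eq_or_lt_of_le hub with rfl | hub
  · exact ⟨u, hb, u, hb, 1 / 2, half, le_rfl, hbe, hbe, by ring⟩
  refine ⟨a, ha, b, hb, (b - u) / (b - a), ⟨div_pos (by linarith) (by linarith), ?_⟩,
    by linarith, hae, hbe, ?_⟩
  · rw [div_lt_one (by linarith)]; linarith
  · have : b - a ≠ 0 := by linarith
    field_simp
    ring

theorem convHullFun_eq_of_isSubgradientAt (h : IsSuperlinearOn G f) {z u : ℝ}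
    (hu : IsSubgradientAt (conjOn G f) z u) :
    u ∈ convexHull ℝ G ∧ u * z - convHullFun G f u = conjOn G f z := by
  obtain ⟨a, ha, b, hb, δ, hδ, -, hae, hbe, rfl⟩ := h.exists_combo_of_isSubgradientAt hu
  have hδ' : δ ∈ Icc (0 : ℝ) 1 := Ioo_subset_Icc_self hδ
  have hmem := combo_mem_convexHull ha hb hδ'
  refine ⟨hmem, le_antisymm (h.mul_sub_convHullFun_le hmem z) ?_⟩
  have h1 := h.convHullFun_le_combo ha hb hδ'
  have hfa : f a = a * z - conjOn G f z := by linarith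
  have hfb : f b = b * z - conjOn G f z := by linarith
  rw [hfa, hfb] at h1
  linarith

/-- At a point of differentiability of the conjugate the derivative is the only maximiser of the
convexified problem, and it belongs to the original set of rates. -/
theorem argmaxOn_convHullFun (h : IsSuperlinearOn G f) {z : ℝ}
    (hd : DifferentiableAt ℝ (conjOn G f) z) :
    argmaxOn (convexHull ℝ G) (fun a => a * z - convHullFun G f a) = {deriv (conjOn G f) z} ∧
    deriv (conjOn G f) z ∈ G ∧
    deriv (conjOn G f) z * z - f (deriv (conjOn G f) z) = conjOn G f z ∧
    convHullFun G f (deriv (conjOn G f) z) = f (deriv (conjOn G f) z) := by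
  obtain ⟨a, ha, he⟩ := h.exists_eq_conjOn z
  have had := (h.isSubgradientAt ha he).eq_deriv hd
  have hhull := h.convHullFun_le ha
  have hco := subset_convexHull ℝ G ha
  have hle := h.mul_sub_convHullFun_le hco z
  rw [← had]
  refine ⟨?_, ha, he, by linarith⟩
  ext y
  simp only [argmaxOn, mem_ofPred_eq, mem_singleton_iff]
  constructor
  · rintro ⟨hy, hmax⟩
    have h1 := hmax a hco
    have h2 := h.mul_sub_convHullFun_le hy z
    rw [had]
    exact (h.isSubgradientAt_of_convHullFun hy (by linarith)).eq_deriv hd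
  · rintro rfl
    refine ⟨hco, fun w hw => ?_⟩
    have := h.mul_sub_convHullFun_le hw z
    linarith

end IsSuperlinearOn

/-! ### The Hamiltonian of the firm -/

namespace Firm

variable (M : Firm)

theorem isSuperlinearOn_prod : IsSuperlinearOn M.A M.C where
  isClosed := M.A_closed
  nonneg := M.A_nonneg
  zero_mem := M.zero_mem_A
  continuousOn := M.C_cont
  bound := by
    intro z
    -- above some rate `N` the cost exceeds `a z`
    obtain ⟨N, hN⟩ : ∃ N : ℝ, ∀ a ∈ M.A, N < a → a * z ≤ M.C a := by
      by_cases hb : Bornology.IsBounded M.A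
      · obtain ⟨N, hN⟩ := hb.bddAbove
        exact ⟨N, fun a ha h => absurd (hN ha) (not_le.2 h)⟩
      · have h := (M.C_coercive hb).eventually_ge_atTop z
        rw [eventually_inf_principal] at h
        obtain ⟨N, hN⟩ := eventually_atTop.1 h
        refine ⟨max N 0, fun a ha hlt => ?_⟩
        have h1 := hN a ((le_max_left _ _).trans hlt.le) ha
        rw [le_div_iff₀ ((le_max_right _ _).trans_lt hlt)] at h1
        linarith
    refine ⟨max 0 (N * |z|), fun a ha => ?_⟩
    rcases lt_or_ge N a with h | h
    · exact le_max_of_le_left (by linarith [hN a ha h])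
    · have h1 := mul_le_mul_of_nonneg_left (le_abs_self z) (M.A_nonneg a ha)
      have h2 := mul_le_mul_of_nonneg_right h (abs_nonneg z)
      exact le_max_of_le_right (by linarith [M.C_nonneg a ha])

/-- Selling is treated as production with the cost `-R`, at the price `-z`. -/
theorem isSuperlinearOn_sell : IsSuperlinearOn M.Q (fun y => -M.R y) where
  isClosed := M.Q_compact.isClosed
  nonneg := M.Q_nonneg
  zero_mem := M.zero_mem_Q
  continuousOn := M.R_cont.neg
  bound := by
    intro z
    obtain ⟨B, hB⟩ := (M.Q_compact.image_of_continuousOn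
      ((continuousOn_id.mul continuousOn_const).sub M.R_cont.neg :
        ContinuousOn (fun y => id y * z - -M.R y) M.Q)).bddAbove
    exact ⟨B, fun a ha => hB ⟨a, ha, rfl⟩⟩

theorem Chat_eq : M.Chat = conjOn M.A M.C := rfl

theorem Rhat_eq (z : ℝ) : M.Rhat z = conjOn M.Q (fun y => -M.R y) (-z) := by
  unfold Rhat conjOn
  congr 1
  refine image_congr fun q _ => ?_
  ring

theorem Rtilde_eq (y : ℝ) : M.Rtilde y = -convHullFun M.Q (fun y => -M.R y) y := rfl

theorem convexOn_Chat : ConvexOn ℝ univ M.Chat := M.isSuperlinearOn_prod.convexOn_conjOn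

theorem convexOn_Rhat : ConvexOn ℝ univ M.Rhat := by
  have h := M.isSuperlinearOn_sell.convexOn_conjOn
  refine ⟨convex_univ, fun x _ y _ a b ha hb hab => ?_⟩
  have := h.2 (mem_univ (-x)) (mem_univ (-y)) ha hb hab
  rw [M.Rhat_eq, M.Rhat_eq, M.Rhat_eq]
  convert this using 2
  simp only [smul_eq_mul]; ring

theorem convexOn_H : ConvexOn ℝ univ M.H := M.convexOn_Rhat.add M.convexOn_Chat

theorem continuous_Chat : Continuous M.Chat := M.convexOn_Chat.locallyLipschitz.continuous

theorem continuous_Rhat : Continuous M.Rhat := M.convexOn_Rhat.locallyLipschitz.continuous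

theorem continuous_H : Continuous M.H := M.continuous_Rhat.add M.continuous_Chat

theorem countable_not_differentiableAt :
    {z | ¬ (DifferentiableAt ℝ M.Rhat z ∧ DifferentiableAt ℝ M.Chat z)}.Countable := by
  refine ((M.convexOn_Rhat.countable_not_differentiableAt).union
    (M.convexOn_Chat.countable_not_differentiableAt)).mono ?_
  intro z hz
  by_contra h
  simp only [mem_union, mem_ofPred_eq, not_or, not_not] at h
  exact hz h

theorem isSubgradientAt_Rhat_iff {z u : ℝ} :
    IsSubgradientAt M.Rhat z (-u) ↔ IsSubgradientAt (conjOn M.Q (fun y => -M.R y)) (-z) u := by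
  constructor
  · intro h w
    have := h (-w)
    rw [M.Rhat_eq, M.Rhat_eq, neg_neg] at this
    linarith
  · intro h w
    have := h (-w)
    rw [M.Rhat_eq, M.Rhat_eq]
    linarith

theorem R_le {q : ℝ} (hq : q ∈ M.Q) (z : ℝ) : M.R q ≤ M.Rhat z + z * q := by
  have := M.isSuperlinearOn_sell.le_conjOn hq (-z)
  rw [← M.Rhat_eq] at this
  linarith

theorem Rtilde_le {q : ℝ} (hq : q ∈ M.coQ) (z : ℝ) : M.Rtilde q ≤ M.Rhat z + z * q := by
  have := M.isSuperlinearOn_sell.mul_sub_convHullFun_le hq (-z)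
  rw [← M.Rhat_eq] at this
  rw [Rtilde_eq]
  linarith

theorem le_C {a : ℝ} (ha : a ∈ M.A) (z : ℝ) : z * a - M.Chat z ≤ M.C a := by
  have : a * z - M.C a ≤ M.Chat z := M.isSuperlinearOn_prod.le_conjOn ha z
  linarith

theorem le_Ctilde {a : ℝ} (ha : a ∈ M.coA) (z : ℝ) : z * a - M.Chat z ≤ M.Ctilde a := by
  have : a * z - M.Ctilde a ≤ M.Chat z := M.isSuperlinearOn_prod.mul_sub_convHullFun_le ha z
  linarith

theorem Rhat_nonneg (z : ℝ) : 0 ≤ M.Rhat z := by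
  have := M.R_le M.zero_mem_Q z
  rw [M.R_zero] at this
  linarith

theorem coA_nonneg {a : ℝ} (ha : a ∈ M.coA) : 0 ≤ a := by
  obtain ⟨b, hb, -, -, h, -⟩ := exists_le_le_of_mem_convexHull ha
  exact (M.A_nonneg b hb).trans h

theorem coQ_nonneg {q : ℝ} (hq : q ∈ M.coQ) : 0 ≤ q := by
  obtain ⟨b, hb, -, -, h, -⟩ := exists_le_le_of_mem_convexHull hq
  exact (M.Q_nonneg b hb).trans h

theorem A_subset_coA : M.A ⊆ M.coA := subset_convexHull ℝ M.A

theorem Q_subset_coQ : M.Q ⊆ M.coQ := subset_convexHull ℝ M.Q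

theorem exists_coQ_le : ∃ K, 0 ≤ K ∧ ∀ q ∈ M.coQ, q ≤ K := by
  obtain ⟨K, hK⟩ := M.Q_compact.bddAbove
  refine ⟨K, hK M.zero_mem_Q, fun q hq => ?_⟩
  obtain ⟨-, -, b, hb, -, h⟩ := exists_le_le_of_mem_convexHull hq
  exact h.trans (hK hb)

theorem Ctilde_nonneg (a : ℝ) : 0 ≤ M.Ctilde a := by
  refine Real.sInf_nonneg ?_
  rintro s ⟨δ, hδ, x₁, h₁, x₂, h₂, -, rfl⟩
  exact add_nonneg (mul_nonneg hδ.1 (M.C_nonneg _ h₁))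
    (mul_nonneg (sub_nonneg.2 hδ.2) (M.C_nonneg _ h₂))

/-! ### The least minimum point of the Hamiltonian -/

theorem tendsto_H_cocompact : Tendsto M.H (cocompact ℝ) atTop := by
  rw [cocompact_eq_atBot_atTop, tendsto_sup]
  constructor
  · obtain ⟨q, hq, hq0⟩ := M.Q_nontrivial
    have hq1 : 0 < q := lt_of_le_of_ne (M.Q_nonneg q hq) (Ne.symm hq0)
    have hlin : Tendsto (fun z : ℝ => (M.R q - M.C 0) + (-q) * z) atBot atTop :=
      tendsto_atTop_add_const_left _ _ (tendsto_id.const_mul_atBot_of_neg (by linarith))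
    refine tendsto_atTop_mono (fun z => ?_) hlin
    have h1 := M.R_le hq z
    have h2 := M.le_C M.zero_mem_A z
    show _ ≤ M.Rhat z + M.Chat z
    linarith
  · obtain ⟨a, ha, ha0⟩ := M.A_nontrivial
    have ha1 : 0 < a := lt_of_le_of_ne (M.A_nonneg a ha) (Ne.symm ha0)
    have hlin : Tendsto (fun z : ℝ => -M.C a + a * z) atTop atTop :=
      tendsto_atTop_add_const_left _ _ (tendsto_id.const_mul_atTop ha1)
    refine tendsto_atTop_mono (fun z => ?_) hlin
    have h1 := M.Rhat_nonneg z
    have h2 := M.le_C ha z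
    show _ ≤ M.Rhat z + M.Chat z
    linarith

theorem isLeast_minPoints : IsLeast M.minPoints M.zeta := by
  obtain ⟨z₀, hz₀⟩ := M.continuous_H.exists_forall_le M.tendsto_H_cocompact
  have hclosed : IsClosed M.minPoints := by
    have : M.minPoints = ⋂ w, {z | M.H z ≤ M.H w} := by ext z; simp [minPoints]
    rw [this]
    exact isClosed_iInter fun w => isClosed_le M.continuous_H continuous_const
  have hbdd : BddBelow M.minPoints := by
    have h1 : Tendsto M.H atBot atTop :=
      M.tendsto_H_cocompact.mono_left (by rw [cocompact_eq_atBot_atTop]; exact le_sup_left)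
    obtain ⟨m, hm⟩ := eventually_atBot.1 (h1.eventually_gt_atTop (M.H z₀))
    refine ⟨m, fun z hz => ?_⟩
    by_contra hlt
    exact absurd (hz z₀) (not_le.2 (hm z (not_le.1 hlt).le))
  exact ⟨hclosed.csInf_mem ⟨z₀, hz₀⟩ hbdd, fun z hz => csInf_le hbdd hz⟩

theorem H_zeta_le (w : ℝ) : M.H M.zeta ≤ M.H w := M.isLeast_minPoints.1 w

theorem H_zeta_lt {z : ℝ} (hz : z < M.zeta) : M.H M.zeta < M.H z := by
  refine lt_of_le_of_ne (M.H_zeta_le z) fun h => ?_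
  have hmem : z ∈ M.minPoints := fun w => h ▸ M.H_zeta_le w
  exact absurd (M.isLeast_minPoints.2 hmem) (not_le.2 hz)

theorem leftDeriv_H_neg {z : ℝ} (hz : z < M.zeta) : derivWithin M.H (Iio z) z < 0 := by
  have hi : z ∈ interior (univ : Set ℝ) := by simp
  refine lt_of_le_of_lt ((M.convexOn_H.leftDeriv_le_rightDeriv_of_mem_interior hi).trans
    (M.convexOn_H.rightDeriv_le_slope_of_mem_interior hi (mem_univ M.zeta) hz)) ?_
  rw [slope_def_field]
  exact div_neg_of_neg_of_pos (by linarith [M.H_zeta_lt hz]) (by linarith)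

theorem monotone_leftDeriv_H : Monotone fun z => derivWithin M.H (Iio z) z := by
  intro x y hxy
  exact M.convexOn_H.monotoneOn_leftDeriv (by simp) (by simp) hxy

/-! ### Maximisers for the two departments -/

/-- At the prices where `R̂` and `Ĉ` are differentiable, the optimal rates of the two departments
are given by the derivatives, and their difference is the derivative of the Hamiltonian. -/
theorem optimal_rates {z : ℝ} (hR : DifferentiableAt ℝ M.Rhat z)
    (hC : DifferentiableAt ℝ M.Chat z) :
    M.optSell z = {-deriv M.Rhat z} ∧ M.optProd z = {deriv M.Chat z} ∧
    -deriv M.Rhat z ∈ M.Q ∧ deriv M.Chat z ∈ M.A ∧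
    M.R (-deriv M.Rhat z) = M.Rhat z + z * (-deriv M.Rhat z) ∧
    M.C (deriv M.Chat z) = z * deriv M.Chat z - M.Chat z ∧
    M.Rtilde (-deriv M.Rhat z) = M.R (-deriv M.Rhat z) ∧
    M.Ctilde (deriv M.Chat z) = M.C (deriv M.Chat z) ∧
    deriv M.Chat z - (-deriv M.Rhat z) = derivWithin M.H (Iio z) z := by
  have hfun : M.Rhat = fun z => conjOn M.Q (fun y => -M.R y) (-z) := funext M.Rhat_eq
  have hd : DifferentiableAt ℝ (conjOn M.Q (fun y => -M.R y)) (-z) := by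
    rw [hfun] at hR
    exact differentiableAt_comp_neg.1 hR
  have he : -deriv M.Rhat z = deriv (conjOn M.Q (fun y => -M.R y)) (-z) := by
    rw [hfun, deriv_comp_neg, neg_neg]
  obtain ⟨s1, s2, s3, s4⟩ := M.isSuperlinearOn_sell.argmaxOn_convHullFun hd
  obtain ⟨p1, p2, p3, p4⟩ := M.isSuperlinearOn_prod.argmaxOn_convHullFun hC
  rw [← he, ← M.Rhat_eq] at s3
  rw [← he] at s1 s2 s4
  refine ⟨?_, p1, s2, p2, by linarith, ?_, ?_, p4, ?_⟩
  · rw [← s1, optSell, coQ]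
    congr 1
    funext q
    rw [Rtilde_eq]
    ring
  · have : deriv M.Chat z * z - M.C (deriv M.Chat z) = M.Chat z := p3
    linarith
  · rw [Rtilde_eq, s4, neg_neg]
  · have hsum : DifferentiableAt ℝ M.H z := hR.add hC
    rw [hsum.derivWithin (uniqueDiffWithinAt_Iio z)]
    have : deriv M.H z = deriv M.Rhat z + deriv M.Chat z := deriv_add hR hC
    linarith

theorem subgradient_Chat_le {z u : ℝ} (hz : z ≤ M.zeta) (hu : IsSubgradientAt M.Chat z u)
    (hu0 : 0 ≤ u) : u ≤ M.Chat (M.zeta + 1) + M.C 0 :=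
  M.isSuperlinearOn_prod.subgradient_le hu (by linarith) hu0

/-- Weak duality. -/
theorem Rtilde_sub_Ctilde_le {u : ℝ} (hu : u ∈ M.coQ ∩ M.coA) (z : ℝ) :
    M.Rtilde u - M.Ctilde u ≤ M.H z := by
  have h1 := M.Rtilde_le hu.1 z
  have h2 := M.le_Ctilde hu.2 z
  show _ ≤ M.Rhat z + M.Chat z
  linarith

/-- Strong duality: some rate is optimal for both departments of the convexified firm at the
price `ζ`. -/
theorem exists_tight_rate : ∃ u ∈ M.coQ ∩ M.coA,
    M.Rtilde u = M.Rhat M.zeta + M.zeta * u ∧ M.Ctilde u = M.zeta * u - M.Chat M.zeta := by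
  obtain ⟨u, hC, hR⟩ := M.convexOn_Chat.exists_isSubgradientAt_neg M.convexOn_Rhat (z := M.zeta)
    (fun w => by have : M.Rhat _ + M.Chat _ ≤ M.Rhat w + M.Chat w := M.H_zeta_le w; linarith)
  rw [isSubgradientAt_Rhat_iff] at hR
  obtain ⟨hq, hqe⟩ := M.isSuperlinearOn_sell.convHullFun_eq_of_isSubgradientAt hR
  obtain ⟨ha, hae⟩ := M.isSuperlinearOn_prod.convHullFun_eq_of_isSubgradientAt hC
  rw [← Rhat_eq] at hqe
  refine ⟨u, ⟨hq, ha⟩, ?_, ?_⟩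
  · rw [Rtilde_eq]; linarith
  · have : u * M.zeta - M.Ctilde u = M.Chat M.zeta := hae
    linarith

theorem optStaticConv_nonempty : M.optStaticConv.Nonempty := by
  obtain ⟨u, hu, hR, hC⟩ := M.exists_tight_rate
  refine ⟨u, hu, fun w hw => ?_⟩
  have := M.Rtilde_sub_Ctilde_le hw M.zeta
  have h2 : M.H M.zeta = M.Rhat M.zeta + M.Chat M.zeta := rfl
  show M.Rtilde w - M.Ctilde w ≤ M.Rtilde u - M.Ctilde u
  linarith

theorem optStaticConv_tight {u : ℝ} (hu : u ∈ M.optStaticConv) : u ∈ M.coQ ∧ u ∈ M.coA ∧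
    M.Rtilde u = M.Rhat M.zeta + M.zeta * u ∧ M.Ctilde u = M.zeta * u - M.Chat M.zeta := by
  obtain ⟨w, hw, hR, hC⟩ := M.exists_tight_rate
  have h1 : M.Rtilde w - M.Ctilde w ≤ M.Rtilde u - M.Ctilde u := hu.2 w hw
  have h2 := M.Rtilde_le hu.1.1 M.zeta
  have h3 := M.le_Ctilde hu.1.2 M.zeta
  exact ⟨hu.1.1, hu.1.2, by linarith, by linarith⟩

theorem exists_sell_combo {u : ℝ} (hu : u ∈ M.optStaticConv) :
    ∃ q₁ ∈ M.Q, ∃ q₂ ∈ M.Q, ∃ γ ∈ Ioo (0 : ℝ) 1, q₁ ≤ q₂ ∧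
      M.R q₁ = M.Rhat M.zeta + M.zeta * q₁ ∧ M.R q₂ = M.Rhat M.zeta + M.zeta * q₂ ∧
      u = γ * q₁ + (1 - γ) * q₂ := by
  obtain ⟨hQ, -, hR, -⟩ := M.optStaticConv_tight hu
  rw [Rtilde_eq] at hR
  obtain ⟨a, ha, b, hb, δ, hδ, hab, hae, hbe, he⟩ :=
    M.isSuperlinearOn_sell.exists_combo_of_isSubgradientAt
      (M.isSuperlinearOn_sell.isSubgradientAt_of_convHullFun (z := -M.zeta) hQ
        (by rw [← Rhat_eq]; linarith))
  rw [← Rhat_eq] at hae hbe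
  exact ⟨a, ha, b, hb, δ, hδ, hab, by linarith, by linarith, he⟩

theorem exists_prod_combo {u : ℝ} (hu : u ∈ M.optStaticConv) :
    ∃ α₁ ∈ M.A, ∃ α₂ ∈ M.A, ∃ ν ∈ Ioo (0 : ℝ) 1, α₁ ≤ α₂ ∧
      M.C α₁ = M.zeta * α₁ - M.Chat M.zeta ∧ M.C α₂ = M.zeta * α₂ - M.Chat M.zeta ∧
      u = ν * α₁ + (1 - ν) * α₂ := by
  obtain ⟨-, hA, -, hC⟩ := M.optStaticConv_tight hu
  have hsub : IsSubgradientAt (conjOn M.A M.C) M.zeta u :=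
    M.isSuperlinearOn_prod.isSubgradientAt_of_convHullFun hA
      (by have : M.Ctilde u = convHullFun M.A M.C u := rfl
          rw [← Chat_eq]; linarith)
  obtain ⟨a, ha, b, hb, δ, hδ, hab, hae, hbe, he⟩ :=
    M.isSuperlinearOn_prod.exists_combo_of_isSubgradientAt hsub
  rw [← Chat_eq] at hae hbe
  exact ⟨a, ha, b, hb, δ, hδ, hab, by linarith, by linarith, he⟩

theorem sharedOpt_tight {u : ℝ} (hu : u ∈ M.sharedOpt M.zeta) : u ∈ M.Q ∧ u ∈ M.A ∧
    M.R u = M.Rhat M.zeta + M.zeta * u ∧ M.C u = M.zeta * u - M.Chat M.zeta := by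
  obtain ⟨⟨hQ, hq⟩, hA, ha⟩ := hu
  refine ⟨hQ, hA, ?_, ?_⟩
  · obtain ⟨w, hw, he⟩ := M.isSuperlinearOn_sell.exists_eq_conjOn (-M.zeta)
    rw [← Rhat_eq] at he
    have h1 := M.R_le hQ M.zeta
    have h2 := hq w hw
    simp only at h2
    linarith
  · obtain ⟨w, hw, he⟩ := M.isSuperlinearOn_prod.exists_eq_conjOn M.zeta
    rw [← Chat_eq] at he
    have h1 := M.le_C hA M.zeta
    have h2 := ha w hw
    simp only at h2
    linarith

theorem optStatic_nonempty (h : (M.sharedOpt M.zeta).Nonempty) : M.optStatic.Nonempty := by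
  obtain ⟨u, hu⟩ := h
  obtain ⟨hQ, hA, hR, hC⟩ := M.sharedOpt_tight hu
  refine ⟨u, ⟨hQ, hA⟩, fun w hw => ?_⟩
  have h1 := M.R_le hw.1 M.zeta
  have h2 := M.le_C hw.2 M.zeta
  show M.R w - M.C w ≤ M.R u - M.C u
  linarith

theorem optStatic_tight (h : (M.sharedOpt M.zeta).Nonempty) {u : ℝ} (hu : u ∈ M.optStatic) :
    u ∈ M.Q ∧ u ∈ M.A ∧
    M.R u = M.Rhat M.zeta + M.zeta * u ∧ M.C u = M.zeta * u - M.Chat M.zeta := by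
  obtain ⟨w, hw⟩ := h
  obtain ⟨hQ, hA, hR, hC⟩ := M.sharedOpt_tight hw
  have h1 : M.R w - M.C w ≤ M.R u - M.C u := hu.2 w ⟨hQ, hA⟩
  have h2 := M.R_le hu.1.1 M.zeta
  have h3 := M.le_C hu.1.2 M.zeta
  exact ⟨hu.1.1, hu.1.2, by linarith, by linarith⟩

end Firm

/-! ### Discounting and integration by parts -/

theorem integral_discount_mul_eq {β x τ T : ℝ} {g : ℝ → ℝ} (hτT : τ ≤ T)
    (h0 : 0 ≤ τ) (hg : IntervalIntegrable g volume 0 T) :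
    ∫ t in τ..T, Real.exp (-β * t) * g t =
      Real.exp (-β * T) * (x + ∫ s in (0 : ℝ)..T, g s) -
      Real.exp (-β * τ) * (x + ∫ s in (0 : ℝ)..τ, g s) +
      β * ∫ t in τ..T, Real.exp (-β * t) * (x + ∫ s in (0 : ℝ)..t, g s) := by
  set X : ℝ → ℝ := fun t => x + ∫ s in (0 : ℝ)..t, g s with hX
  have hsub : uIcc τ T ⊆ uIcc 0 T := by
    rw [uIcc_of_le hτT, uIcc_of_le (h0.trans hτT)]
    exact Icc_subset_Icc_left h0
  have hXac : AbsolutelyContinuousOnInterval X τ T := by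
    have h1 := (hg.absolutelyContinuousOnInterval_intervalIntegral (c := 0) (by simp)).mono hsub
    have h2 : AbsolutelyContinuousOnInterval (fun _ : ℝ => x) τ T :=
      contDiffOn_const.absolutelyContinuousOnInterval
    exact h2.add h1
  have hexp : ∀ t, HasDerivAt (fun t => Real.exp (-β * t)) (-β * Real.exp (-β * t)) t := fun t => by
    simpa [mul_comm] using ((hasDerivAt_id t).const_mul (-β)).exp
  have hEac : AbsolutelyContinuousOnInterval (fun t => Real.exp (-β * t)) τ T := by
    have : ContDiff ℝ 1 (fun t => Real.exp (-β * t)) := by fun_prop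
    exact this.contDiffOn.absolutelyContinuousOnInterval
  have hparts := hEac.integral_mul_deriv_eq_deriv_mul hXac
  have h1 : ∫ t in τ..T, Real.exp (-β * t) * deriv X t = ∫ t in τ..T, Real.exp (-β * t) * g t := by
    refine intervalIntegral.integral_congr_ae ?_
    filter_upwards [hg.ae_hasDerivAt_integral] with t ht hmem
    have := (ht (hsub (uIoc_subset_uIcc hmem)) 0 (by simp)).const_add x
    rw [show deriv X t = g t from this.deriv]
  have h2 : ∫ t in τ..T, deriv (fun t => Real.exp (-β * t)) t * X t =
      -β * ∫ t in τ..T, Real.exp (-β * t) * X t := by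
    rw [← intervalIntegral.integral_const_mul]
    refine intervalIntegral.integral_congr fun t _ => ?_
    simp only [(hexp t).deriv]
    ring
  rw [← h1, hparts, h2]
  ring

theorem integrable_discount {β : ℝ} (hβ : 0 < β) :
    Integrable (fun t => Real.exp (-β * t)) (volume.restrict (Ici 0)) := by
  rw [← restrict_Ioi_eq_restrict_Ici]
  exact exp_neg_integrableOn_Ioi 0 hβ

theorem integrable_discount_mul {β K : ℝ} (hβ : 0 < β) {g : ℝ → ℝ}
    (hg : AEStronglyMeasurable g (volume.restrict (Ici 0)))
    (hK : ∀ᵐ t ∂(volume.restrict (Ici 0)), |g t| ≤ K) :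
    Integrable (fun t => Real.exp (-β * t) * g t) (volume.restrict (Ici 0)) := by
  have := (integrable_discount hβ).bdd_mul hg (c := K) (by simpa using hK)
  simpa [mul_comm] using this

theorem tendsto_integral_Ici {f : ℝ → ℝ} (hf : Integrable f (volume.restrict (Ici 0))) :
    Tendsto (fun T => ∫ t in (0 : ℝ)..T, f t) atTop (𝓝 (∫ t in Ici (0 : ℝ), f t)) := by
  rw [← restrict_Ioi_eq_restrict_Ici] at hf ⊢
  exact intervalIntegral_tendsto_integral_Ioi 0 hf tendsto_id

theorem intervalIntegrable_of_Ici {f : ℝ → ℝ} (hf : Integrable f (volume.restrict (Ici 0)))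
    {T : ℝ} (hT : 0 ≤ T) : IntervalIntegrable f volume 0 T := by
  refine IntegrableOn.intervalIntegrable ?_
  rw [uIcc_of_le hT]
  exact IntegrableOn.mono_set hf Icc_subset_Ici_self

theorem discounted_eq (β : ℝ) (g : ℝ → ℝ) :
    discounted β (fun t => ENNReal.ofReal (g t)) =
      ∫⁻ t in Ici (0 : ℝ), ENNReal.ofReal (Real.exp (-β * t) * g t) := by
  refine lintegral_congr fun t => ?_
  rw [ENNReal.ofReal_mul (Real.exp_pos _).le]

theorem discounted_mono_ae {β : ℝ} {g h : ℝ → ℝ≥0∞}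
    (hgh : ∀ᵐ t ∂(volume.restrict (Ici (0 : ℝ))), g t ≤ h t) :
    discounted β g ≤ discounted β h := by
  refine lintegral_mono_ae ?_
  filter_upwards [hgh] with t ht
  gcongr

theorem ofReal_integral_le_lintegral {μ : Measure ℝ} {f : ℝ → ℝ} (hf : Integrable f μ) :
    ENNReal.ofReal (∫ t, f t ∂μ) ≤ ∫⁻ t, ENNReal.ofReal (f t) ∂μ := by
  rw [integral_eq_lintegral_pos_part_sub_lintegral_neg_part hf]
  refine (ENNReal.ofReal_le_ofReal (sub_le_self _ ENNReal.toReal_nonneg)).trans ?_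
  exact ENNReal.ofReal_toReal_le

/-! ### The dual bound for the value -/

namespace Firm

variable (M : Firm)

/-- The shadow price at time `t` of an inventory that is sold out at time `τ`: it grows at the
rate `β` until it reaches `ζ` at time `τ`, and is constant afterwards. -/
noncomputable def price (τ t : ℝ) : ℝ := M.zeta * Real.exp (-M.β * max (τ - t) 0)

/-- The Lagrangian dual objective, with the discounted shadow price as the multiplier of the
inventory constraint. -/
noncomputable def dualValue (τ x : ℝ) : ℝ :=
  M.zeta * Real.exp (-M.β * τ) * x +
    ∫ t in Ici (0 : ℝ), Real.exp (-M.β * t) * M.H (M.price τ t)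

theorem continuous_price (τ : ℝ) : Continuous (M.price τ) := by
  unfold price; fun_prop

variable {M}

theorem price_pos (hζ : 0 < M.zeta) (τ t : ℝ) : 0 < M.price τ t :=
  mul_pos hζ (Real.exp_pos _)

theorem price_le (hζ : 0 < M.zeta) (τ t : ℝ) : M.price τ t ≤ M.zeta := by
  refine mul_le_of_le_one_right hζ.le (Real.exp_le_one_iff.2 ?_)
  have := mul_nonneg M.β_pos.le (le_max_right (τ - t) 0)
  linarith

theorem price_of_le {τ t : ℝ} (h : τ ≤ t) : M.price τ t = M.zeta := by
  simp [price, max_eq_right (sub_nonpos.2 h)]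

theorem price_of_ge {τ t : ℝ} (h : t ≤ τ) :
    M.price τ t = M.zeta * Real.exp (-M.β * (τ - t)) := by
  simp [price, max_eq_left (sub_nonneg.2 h)]

theorem price_lt (hζ : 0 < M.zeta) {τ t : ℝ} (h : t < τ) : M.price τ t < M.zeta := by
  rw [price_of_ge h.le]
  refine mul_lt_of_lt_one_right hζ (by rw [Real.exp_lt_one_iff]; linarith [mul_pos M.β_pos (sub_pos.2 h)])

theorem exists_price_comp_bound (hζ : 0 < M.zeta) (τ : ℝ) {φ : ℝ → ℝ} (hφ : Continuous φ) :
    ∃ K, ∀ t, |φ (M.price τ t)| ≤ K := by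
  obtain ⟨K, hK⟩ := isCompact_Icc.exists_bound_of_continuousOn (s := Icc 0 M.zeta) hφ.continuousOn
  exact ⟨K, fun t => hK _ ⟨(price_pos hζ τ t).le, price_le hζ τ t⟩⟩

theorem integrable_discount_price_comp (hζ : 0 < M.zeta) (τ : ℝ) {φ : ℝ → ℝ}
    (hφ : Continuous φ) :
    Integrable (fun t => Real.exp (-M.β * t) * φ (M.price τ t)) (volume.restrict (Ici 0)) := by
  obtain ⟨K, hK⟩ := exists_price_comp_bound hζ τ hφ
  exact integrable_discount_mul M.β_pos (hφ.comp (M.continuous_price τ)).aestronglyMeasurable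
    (Eventually.of_forall hK)

/-- The discounted shadow price is constant up to time `τ` and proportional to `e^{-βt}`
afterwards. Hence its product with the net production integrates to boundary terms and an integral
of the inventory over times after `τ`. -/
theorem integral_discount_price_mul {x τ T : ℝ} {g : ℝ → ℝ} (h0 : 0 ≤ τ) (hτT : τ ≤ T)
    (hg : IntervalIntegrable g volume 0 T) :
    ∫ t in (0 : ℝ)..T, Real.exp (-M.β * t) * (M.price τ t * g t) =
      M.zeta * Real.exp (-M.β * T) * (x + ∫ s in (0 : ℝ)..T, g s) -
      M.zeta * Real.exp (-M.β * τ) * x +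
      M.zeta * (M.β * ∫ t in τ..T, Real.exp (-M.β * t) * (x + ∫ s in (0 : ℝ)..t, g s)) := by
  have hsub1 : uIcc 0 τ ⊆ uIcc 0 T := by
    rw [uIcc_of_le h0, uIcc_of_le (h0.trans hτT)]
    exact Icc_subset_Icc_right hτT
  have hsub2 : uIcc τ T ⊆ uIcc 0 T := by
    rw [uIcc_of_le hτT, uIcc_of_le (h0.trans hτT)]
    exact Icc_subset_Icc_left h0
  have hint : IntervalIntegrable (fun t => Real.exp (-M.β * t) * (M.price τ t * g t))
      volume 0 T := by
    have hc : Continuous (fun t => Real.exp (-M.β * t) * M.price τ t) :=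
      (by fun_prop : Continuous fun t => Real.exp (-M.β * t)).mul (M.continuous_price τ)
    simpa [mul_assoc] using hg.continuousOn_mul hc.continuousOn
  rw [← intervalIntegral.integral_add_adjacent_intervals (hint.mono_set hsub1)
    (hint.mono_set hsub2)]
  have h1 : ∫ t in (0 : ℝ)..τ, Real.exp (-M.β * t) * (M.price τ t * g t) =
      M.zeta * Real.exp (-M.β * τ) * ∫ t in (0 : ℝ)..τ, g t := by
    rw [← intervalIntegral.integral_const_mul]
    refine intervalIntegral.integral_congr fun t ht => ?_
    rw [uIcc_of_le h0] at ht
    have : Real.exp (-M.β * τ) = Real.exp (-M.β * t) * Real.exp (-M.β * (τ - t)) := by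
      rw [← Real.exp_add]; ring_nf
    simp only [price_of_ge ht.2, this]
    ring
  have h2 : ∫ t in τ..T, Real.exp (-M.β * t) * (M.price τ t * g t) =
      M.zeta * ∫ t in τ..T, Real.exp (-M.β * t) * g t := by
    rw [← intervalIntegral.integral_const_mul]
    refine intervalIntegral.integral_congr fun t ht => ?_
    rw [uIcc_of_le hτT] at ht
    simp only [price_of_le ht.1]
    ring
  rw [h1, h2, integral_discount_mul_eq (x := x) hτT h0 hg]
  ring

/-- The total of revenue minus cost at the shadow price, before the limit `T → ∞`. -/
theorem integral_dual_gap (hζ : 0 < M.zeta) {x τ T : ℝ} {a q : ℝ → ℝ} (h0 : 0 ≤ τ) (hτT : τ ≤ T)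
    (ha : IntervalIntegrable a volume 0 T) (hq : IntervalIntegrable q volume 0 T) :
    (∫ t in (0 : ℝ)..T, Real.exp (-M.β * t) * (M.Rhat (M.price τ t) + M.price τ t * q t)) -
      (∫ t in (0 : ℝ)..T, Real.exp (-M.β * t) * (M.price τ t * a t - M.Chat (M.price τ t))) =
    (∫ t in (0 : ℝ)..T, Real.exp (-M.β * t) * M.H (M.price τ t)) +
      M.zeta * Real.exp (-M.β * τ) * x -
      (M.zeta * Real.exp (-M.β * T) * inventory x a q T +
        M.zeta * (M.β * ∫ t in τ..T, Real.exp (-M.β * t) * inventory x a q t)) := by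
  have hT := h0.trans hτT
  have he : Continuous fun t => Real.exp (-M.β * t) := by fun_prop
  have iR := intervalIntegrable_of_Ici (integrable_discount_price_comp hζ τ M.continuous_Rhat) hT
  have iC := intervalIntegrable_of_Ici (integrable_discount_price_comp hζ τ M.continuous_Chat) hT
  have iH := intervalIntegrable_of_Ici (integrable_discount_price_comp hζ τ M.continuous_H) hT
  have hmul : ∀ {g : ℝ → ℝ}, IntervalIntegrable g volume 0 T →
      IntervalIntegrable (fun t => Real.exp (-M.β * t) * (M.price τ t * g t)) volume 0 T := by
    intro g hg
    simpa [mul_assoc] using hg.continuousOn_mul (he.mul (M.continuous_price τ)).continuousOn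
  have iq := hmul hq
  have ia := hmul ha
  have ig := hmul (ha.sub hq)
  have key := integral_discount_price_mul (M := M) (x := x) h0 hτT (ha.sub hq)
  have hinv : ∀ t, x + ∫ s in (0 : ℝ)..t, (a s - q s) = inventory x a q t := fun t => rfl
  simp only [hinv] at key
  have e1 : ∫ t in (0 : ℝ)..T, Real.exp (-M.β * t) * (M.price τ t * (a t - q t)) =
      (∫ t in (0 : ℝ)..T, Real.exp (-M.β * t) * M.H (M.price τ t)) -
      ((∫ t in (0 : ℝ)..T, Real.exp (-M.β * t) * (M.Rhat (M.price τ t) + M.price τ t * q t)) -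
      (∫ t in (0 : ℝ)..T, Real.exp (-M.β * t) *
        (M.price τ t * a t - M.Chat (M.price τ t)))) := by
    have iR' : IntervalIntegrable (fun t => Real.exp (-M.β * t) *
        (M.Rhat (M.price τ t) + M.price τ t * q t)) volume 0 T := by
      simpa [mul_add] using iR.add iq
    have iC' : IntervalIntegrable (fun t => Real.exp (-M.β * t) *
        (M.price τ t * a t - M.Chat (M.price τ t))) volume 0 T := by
      simpa [mul_sub] using ia.sub iC
    rw [← intervalIntegral.integral_sub iR' iC', ← intervalIntegral.integral_sub iH (iR'.sub iC')]
    refine intervalIntegral.integral_congr fun t _ => ?_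
    simp only [H]
    ring
  linarith

theorem tendsto_dualValue (hζ : 0 < M.zeta) (τ x : ℝ) :
    Tendsto (fun T => (∫ t in (0 : ℝ)..T, Real.exp (-M.β * t) * M.H (M.price τ t)) +
      M.zeta * Real.exp (-M.β * τ) * x) atTop (𝓝 (M.dualValue τ x)) := by
  have := (tendsto_integral_Ici (integrable_discount_price_comp hζ τ M.continuous_H)).add_const
    (M.zeta * Real.exp (-M.β * τ) * x)
  rwa [add_comm] at this

/-- The discounted revenue bound is integrable, since demand rates are bounded. -/
theorem integrable_revenue_bound (hζ : 0 < M.zeta) (τ : ℝ) {q : ℝ → ℝ} {K : ℝ}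
    (hq : AEStronglyMeasurable q (volume.restrict (Ici 0)))
    (hqK : ∀ᵐ t ∂(volume.restrict (Ici (0 : ℝ))), |q t| ≤ K) :
    Integrable (fun t => Real.exp (-M.β * t) * (M.Rhat (M.price τ t) + M.price τ t * q t))
      (volume.restrict (Ici 0)) := by
  have h1 := integrable_discount_price_comp hζ τ M.continuous_Rhat
  have h2 : Integrable (fun t => Real.exp (-M.β * t) * (M.price τ t * q t))
      (volume.restrict (Ici 0)) := by
    refine integrable_discount_mul (K := M.zeta * K) M.β_pos
      ((M.continuous_price τ).aestronglyMeasurable.mul hq) ?_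
    filter_upwards [hqK] with t ht
    rw [abs_mul, abs_of_pos (price_pos hζ τ t)]
    exact mul_le_mul (price_le hζ τ t) ht (abs_nonneg _) hζ.le
  refine (h1.add h2).congr (Eventually.of_forall fun t => ?_)
  simp only [Pi.add_apply]
  ring

/-- Weak duality: no strategy with a non-negative inventory earns more than the dual objective.
The strategy enters only through its mean rates `a`, `q` and bounds for its revenue and cost, so
that this applies to ordinary, convexified and relaxed controls. -/
theorem discounted_sub_le_dualValue (hζ : 0 < M.zeta) {x τ K : ℝ} (h0 : 0 ≤ τ) {a q : ℝ → ℝ}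
    {r c : ℝ → ℝ≥0∞} (ha : ∀ T, 0 ≤ T → IntervalIntegrable a volume 0 T)
    (hq : AEStronglyMeasurable q (volume.restrict (Ici 0)))
    (hqK : ∀ᵐ t ∂(volume.restrict (Ici (0 : ℝ))), 0 ≤ q t ∧ q t ≤ K)
    (hX : ∀ t, 0 ≤ t → 0 ≤ inventory x a q t)
    (hr : ∀ᵐ t ∂(volume.restrict (Ici (0 : ℝ))),
      r t ≤ ENNReal.ofReal (M.Rhat (M.price τ t) + M.price τ t * q t))
    (hc : ∀ᵐ t ∂(volume.restrict (Ici (0 : ℝ))),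
      ENNReal.ofReal (M.price τ t * a t - M.Chat (M.price τ t)) ≤ c t) :
    (discounted M.β r : EReal) - (discounted M.β c : EReal) ≤ (M.dualValue τ x : EReal) := by
  have hqK' : ∀ᵐ t ∂(volume.restrict (Ici (0 : ℝ))), |q t| ≤ K := by
    filter_upwards [hqK] with t ht
    rw [abs_of_nonneg ht.1]; exact ht.2
  have iρ := integrable_revenue_bound hζ τ hq hqK'
  set ρ := fun t => Real.exp (-M.β * t) * (M.Rhat (M.price τ t) + M.price τ t * q t) with hρ
  have hρ0 : 0 ≤ᵐ[volume.restrict (Ici (0 : ℝ))] ρ := by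
    filter_upwards [hqK] with t ht
    exact mul_nonneg (Real.exp_pos _).le (add_nonneg (M.Rhat_nonneg _)
      (mul_nonneg (price_pos hζ τ t).le ht.1))
  have hDr : discounted M.β r ≤ ENNReal.ofReal (∫ t in Ici (0 : ℝ), ρ t) := by
    rw [ofReal_integral_eq_lintegral_ofReal iρ hρ0]
    exact (discounted_mono_ae hr).trans_eq (discounted_eq _ _)
  by_cases htop : discounted M.β c = ⊤
  · rw [htop]
    have : (discounted M.β r : EReal) - ((⊤ : ℝ≥0∞) : EReal) = ⊥ := by
      rw [EReal.coe_ennreal_top]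
      exact EReal.sub_top _
    rw [this]
    exact bot_le
  have hDr' : (discounted M.β r : EReal) ≤ ((∫ t in Ici (0 : ℝ), ρ t : ℝ) : EReal) := by
    refine (EReal.coe_ennreal_le_coe_ennreal_iff.2 hDr).trans ?_
    rw [EReal.coe_ennreal_ofReal, max_eq_left (integral_nonneg_of_ae hρ0)]
  refine (EReal.sub_le_sub hDr' le_rfl).trans ?_
  rw [← EReal.coe_ennreal_toReal htop, ← EReal.coe_sub, EReal.coe_le_coe_iff]
  refine le_of_tendsto_of_tendsto ((tendsto_integral_Ici iρ).sub_const _)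
    (tendsto_dualValue hζ τ x) ?_
  filter_upwards [eventually_ge_atTop τ] with T hT
  have hT0 := h0.trans hT
  have iq : IntervalIntegrable q volume 0 T := by
    refine IntegrableOn.intervalIntegrable ?_
    rw [uIcc_of_le hT0]
    have hle : volume.restrict (Icc 0 T) ≤ volume.restrict (Ici (0 : ℝ)) :=
      Measure.restrict_mono Icc_subset_Ici_self le_rfl
    refine Integrable.mono' (integrable_const K) (hq.mono_measure hle) ?_
    exact ae_mono hle hqK'
  have hgap := integral_dual_gap hζ (x := x) h0 hT (ha T hT0) iq
  have hXT := mul_nonneg (mul_nonneg hζ.le (Real.exp_pos (-M.β * T)).le) (hX T hT0)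
  have hXint : 0 ≤ ∫ t in τ..T, Real.exp (-M.β * t) * inventory x a q t :=
    intervalIntegral.integral_nonneg hT fun t ht =>
      mul_nonneg (Real.exp_pos _).le (hX t (h0.trans ht.1))
  have hXint' := mul_nonneg hζ.le (mul_nonneg M.β_pos.le hXint)
  have hcost : ∫ t in (0 : ℝ)..T, Real.exp (-M.β * t) *
      (M.price τ t * a t - M.Chat (M.price τ t)) ≤ (discounted M.β c).toReal := by
    have iκ : IntervalIntegrable (fun t => Real.exp (-M.β * t) *
        (M.price τ t * a t - M.Chat (M.price τ t))) volume 0 T := by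
      have he : Continuous fun t => Real.exp (-M.β * t) := by fun_prop
      have i1 := (ha T hT0).continuousOn_mul (he.mul (M.continuous_price τ)).continuousOn
      have i2 := intervalIntegrable_of_Ici
        (integrable_discount_price_comp hζ τ M.continuous_Chat) hT0
      simpa [mul_sub, mul_assoc] using i1.sub i2
    rw [intervalIntegral.integral_of_le hT0]
    rw [intervalIntegrable_iff_integrableOn_Ioc_of_le hT0] at iκ
    have h1 := ofReal_integral_le_lintegral iκ
    have h2 : ∫⁻ t in Ioc 0 T, ENNReal.ofReal (Real.exp (-M.β * t) *
        (M.price τ t * a t - M.Chat (M.price τ t))) ≤ discounted M.β c := by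
      refine (lintegral_mono_set (Ioc_subset_Icc_self.trans Icc_subset_Ici_self)).trans ?_
      rw [← discounted_eq]
      exact discounted_mono_ae hc
    exact (ENNReal.ofReal_le_iff_le_toReal htop).1 (h1.trans h2)
  linarith

/-- The dual objective is attained up to `ζ ε` by a strategy that uses optimal rates at the shadow
price and keeps the inventory below `ε` after time `τ`. -/
theorem dualValue_sub_le_discounted_sub (hζ : 0 < M.zeta) {x τ K ε : ℝ} (h0 : 0 ≤ τ) (hε : 0 ≤ ε)
    {a q : ℝ → ℝ} {r c : ℝ → ℝ≥0∞}
    (ha : AEStronglyMeasurable a (volume.restrict (Ici 0)))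
    (haK : ∀ᵐ t ∂(volume.restrict (Ici (0 : ℝ))), |a t| ≤ K)
    (hq : AEStronglyMeasurable q (volume.restrict (Ici 0)))
    (hqK : ∀ᵐ t ∂(volume.restrict (Ici (0 : ℝ))), |q t| ≤ K)
    (hX : ∀ t, τ ≤ t → inventory x a q t ≤ ε)
    (hr : ∀ᵐ t ∂(volume.restrict (Ici (0 : ℝ))),
      ENNReal.ofReal (M.Rhat (M.price τ t) + M.price τ t * q t) ≤ r t)
    (hc : ∀ᵐ t ∂(volume.restrict (Ici (0 : ℝ))),
      c t ≤ ENNReal.ofReal (M.price τ t * a t - M.Chat (M.price τ t)))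
    (hc0 : ∀ᵐ t ∂(volume.restrict (Ici (0 : ℝ))),
      0 ≤ M.price τ t * a t - M.Chat (M.price τ t)) :
    ((M.dualValue τ x - M.zeta * ε : ℝ) : EReal) ≤
      (discounted M.β r : EReal) - (discounted M.β c : EReal) := by
  have iρ := integrable_revenue_bound hζ τ hq hqK
  have iκ : Integrable (fun t => Real.exp (-M.β * t) *
      (M.price τ t * a t - M.Chat (M.price τ t))) (volume.restrict (Ici 0)) := by
    have h1 := integrable_discount_price_comp hζ τ M.continuous_Chat
    have h2 := (integrable_revenue_bound hζ τ ha haK).sub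
      (integrable_discount_price_comp hζ τ M.continuous_Rhat)
    refine (h2.sub h1).congr (Eventually.of_forall fun t => ?_)
    simp only [Pi.sub_apply]
    ring
  have hDr : ((∫ t in Ici (0 : ℝ), Real.exp (-M.β * t) *
      (M.Rhat (M.price τ t) + M.price τ t * q t) : ℝ) : EReal) ≤ discounted M.β r := by
    have h := (ofReal_integral_le_lintegral iρ).trans
      ((discounted_eq _ _).symm.le.trans (discounted_mono_ae hr))
    refine le_trans ?_ (EReal.coe_ennreal_le_coe_ennreal_iff.2 h)
    rw [EReal.coe_ennreal_ofReal]
    exact EReal.coe_le_coe_iff.2 (le_max_left _ _)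
  have hDc : (discounted M.β c : EReal) ≤ ((∫ t in Ici (0 : ℝ), Real.exp (-M.β * t) *
      (M.price τ t * a t - M.Chat (M.price τ t)) : ℝ) : EReal) := by
    have hκ0 : 0 ≤ᵐ[volume.restrict (Ici (0 : ℝ))] fun t => Real.exp (-M.β * t) *
        (M.price τ t * a t - M.Chat (M.price τ t)) := by
      filter_upwards [hc0] with t ht
      exact mul_nonneg (Real.exp_pos _).le ht
    have h := (discounted_mono_ae (β := M.β) hc).trans_eq (discounted_eq _ _)
    rw [← ofReal_integral_eq_lintegral_ofReal iκ hκ0] at h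
    refine (EReal.coe_ennreal_le_coe_ennreal_iff.2 h).trans ?_
    rw [EReal.coe_ennreal_ofReal, max_eq_left (integral_nonneg_of_ae hκ0)]
  refine le_trans ?_ (EReal.sub_le_sub hDr hDc)
  rw [← EReal.coe_sub, EReal.coe_le_coe_iff]
  refine le_of_tendsto_of_tendsto ((tendsto_dualValue hζ τ x).sub_const _)
    ((tendsto_integral_Ici iρ).sub (tendsto_integral_Ici iκ)) ?_
  filter_upwards [eventually_ge_atTop τ] with T hT
  have hT0 := h0.trans hT
  have hle : volume.restrict (Icc 0 T) ≤ volume.restrict (Ici (0 : ℝ)) :=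
    Measure.restrict_mono Icc_subset_Ici_self le_rfl
  have hbdd : ∀ {g : ℝ → ℝ}, AEStronglyMeasurable g (volume.restrict (Ici 0)) →
      (∀ᵐ t ∂(volume.restrict (Ici (0 : ℝ))), |g t| ≤ K) → IntervalIntegrable g volume 0 T := by
    intro g hg hgK
    refine IntegrableOn.intervalIntegrable ?_
    rw [uIcc_of_le hT0]
    exact Integrable.mono' (integrable_const K) (hg.mono_measure hle) (ae_mono hle hgK)
  have ia := hbdd ha haK
  have iq := hbdd hq hqK
  rw [integral_dual_gap hζ (x := x) h0 hT ia iq]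
  have hXc : ContinuousOn (fun t => inventory x a q t) (Icc τ T) := by
    have := intervalIntegral.continuousOn_primitive_interval' (ia.sub iq) (a := 0) (by simp)
    rw [uIcc_of_le hT0] at this
    exact continuousOn_const.add (this.mono (Icc_subset_Icc_left h0))
  have hec : Continuous fun t => Real.exp (-M.β * t) := by fun_prop
  have h1 : ∫ t in τ..T, Real.exp (-M.β * t) * inventory x a q t ≤
      ∫ t in τ..T, Real.exp (-M.β * t) * ε := by
    refine intervalIntegral.integral_mono_on hT ?_ ?_ fun t ht =>
      mul_le_mul_of_nonneg_left (hX t ht.1) (Real.exp_pos _).le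
    · refine ContinuousOn.intervalIntegrable ?_
      rw [uIcc_of_le hT]
      exact hec.continuousOn.mul hXc
    · exact (hec.mul continuous_const).intervalIntegrable _ _
  have h2 : M.β * ∫ t in τ..T, Real.exp (-M.β * t) * ε =
      (Real.exp (-M.β * τ) - Real.exp (-M.β * T)) * ε := by
    rw [intervalIntegral.integral_mul_const,
      intervalIntegral.integral_comp_mul_left Real.exp (neg_ne_zero.2 M.β_pos.ne'), integral_exp]
    have := M.β_pos.ne'
    simp only [smul_eq_mul]
    field_simp
    ring
  have h3 := mul_le_mul_of_nonneg_left h1 M.β_pos.le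
  rw [h2] at h3
  have h4 : Real.exp (-M.β * T) * inventory x a q T ≤ Real.exp (-M.β * T) * ε :=
    mul_le_mul_of_nonneg_left (hX T hT) (Real.exp_pos _).le
  have h5 : Real.exp (-M.β * τ) * ε ≤ ε := by
    refine mul_le_of_le_one_left hε (Real.exp_le_one_iff.2 ?_)
    linarith [mul_nonneg M.β_pos.le h0]
  have h6 := mul_le_mul_of_nonneg_left (add_le_add h4 h3) hζ.le
  have h7 := mul_le_mul_of_nonneg_left h5 hζ.le
  linarith

end Firm

/-! ### Selling out the inventory -/

namespace Firm

variable (M : Firm)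

/-- The rate at which the inventory falls when it is going to be sold out after the time `s`,
that is, minus the derivative of the Hamiltonian at the shadow price `ζ e^{-βs}`. The left
derivative is used, so that the rate is monotone and defined everywhere. -/
noncomputable def drainRate (s : ℝ) : ℝ :=
  -derivWithin M.H (Iio (M.zeta * Real.exp (-M.β * s))) (M.zeta * Real.exp (-M.β * s))

/-- The inventory that is sold out at time `τ ≥ 0`. For `τ < 0` the value is `τ`, which makes this
an increasing bijection of the line. -/
noncomputable def drain (τ : ℝ) : ℝ := (∫ s in (0 : ℝ)..max τ 0, M.drainRate s) + min τ 0

variable {M}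

theorem monotone_drainRate (hζ : 0 < M.zeta) : Monotone M.drainRate := by
  intro s t hst
  refine neg_le_neg (M.monotone_leftDeriv_H ?_)
  refine mul_le_mul_of_nonneg_left (Real.exp_le_exp.2 ?_) hζ.le
  have := mul_le_mul_of_nonneg_left hst M.β_pos.le
  linarith

theorem drainRate_pos (hζ : 0 < M.zeta) {s : ℝ} (hs : 0 < s) : 0 < M.drainRate s := by
  refine neg_pos.2 (M.leftDeriv_H_neg (mul_lt_of_lt_one_right hζ ?_))
  rw [Real.exp_lt_one_iff]
  linarith [mul_pos M.β_pos hs]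

theorem intervalIntegrable_drainRate (hζ : 0 < M.zeta) (a b : ℝ) :
    IntervalIntegrable M.drainRate volume a b :=
  (monotone_drainRate hζ).intervalIntegrable

theorem drain_of_nonneg {τ : ℝ} (hτ : 0 ≤ τ) :
    M.drain τ = ∫ s in (0 : ℝ)..τ, M.drainRate s := by
  simp [drain, max_eq_left hτ, min_eq_right hτ]

theorem drain_zero : M.drain 0 = 0 := by simp [drain]

theorem drain_sub_drain (hζ : 0 < M.zeta) {σ τ : ℝ} (hσ : 0 ≤ σ) (hτ : 0 ≤ τ) :
    M.drain τ - M.drain σ = ∫ s in σ..τ, M.drainRate s := by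
  rw [drain_of_nonneg hσ, drain_of_nonneg hτ]
  exact intervalIntegral.integral_interval_sub_left (intervalIntegrable_drainRate hζ _ _)
    (intervalIntegrable_drainRate hζ _ _)

theorem continuous_drain (hζ : 0 < M.zeta) : Continuous M.drain := by
  have h := intervalIntegral.continuous_primitive (intervalIntegrable_drainRate (M := M) hζ) 0
  exact (h.comp (continuous_id.max continuous_const)).add (continuous_id.min continuous_const)

theorem strictMono_drain (hζ : 0 < M.zeta) : StrictMono M.drain := by
  have h1 : StrictMonoOn M.drain (Ici 0) := by
    intro σ hσ τ hτ hστ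
    rw [← sub_pos, drain_sub_drain hζ hσ hτ]
    refine intervalIntegral.intervalIntegral_pos_of_pos_on (intervalIntegrable_drainRate hζ _ _)
      (fun s hs => drainRate_pos hζ (lt_of_le_of_lt hσ hs.1)) hστ
  have h2 : StrictMonoOn M.drain (Iic 0) := by
    intro σ hσ τ hτ hστ
    simpa [drain, max_eq_right (show σ ≤ 0 from hσ), max_eq_right (show τ ≤ 0 from hτ),
      min_eq_left (show σ ≤ 0 from hσ), min_eq_left (show τ ≤ 0 from hτ)] using hστ
  exact h2.Iic_union_Ici h1

theorem surjective_drain (hζ : 0 < M.zeta) : Function.Surjective M.drain := by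
  refine (continuous_drain hζ).surjective ?_ ?_
  · have hpos := drainRate_pos hζ one_pos
    have hlin : Tendsto (fun τ : ℝ => M.drain 1 - M.drainRate 1 + M.drainRate 1 * τ)
        atTop atTop :=
      tendsto_atTop_add_const_left _ _ (tendsto_id.const_mul_atTop hpos)
    refine tendsto_atTop_mono' _ ?_ hlin
    filter_upwards [eventually_ge_atTop 1] with τ hτ
    have h1 : ∫ _ in (1 : ℝ)..τ, M.drainRate 1 ≤ ∫ s in (1 : ℝ)..τ, M.drainRate s :=
      intervalIntegral.integral_mono_on hτ (by simp) (intervalIntegrable_drainRate hζ _ _)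
        fun s hs => monotone_drainRate hζ hs.1
    rw [← drain_sub_drain hζ zero_le_one (zero_le_one.trans hτ),
      intervalIntegral.integral_const] at h1
    simp only [smul_eq_mul] at h1
    linarith
  · refine tendsto_id.congr' ?_
    filter_upwards [eventually_le_atBot 0] with τ hτ
    simp [drain, max_eq_right hτ, min_eq_left hτ]

/-- The order isomorphism of the line given by `drain`; its inverse maps an inventory to the time
at which it is sold out. -/
noncomputable def drainIso (hζ : 0 < M.zeta) : ℝ ≃o ℝ :=
  (strictMono_drain hζ).orderIsoOfSurjective M.drain (surjective_drain hζ)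

theorem drain_symm (hζ : 0 < M.zeta) (y : ℝ) : M.drain ((drainIso hζ).symm y) = y :=
  (drainIso hζ).apply_symm_apply y

theorem symm_drain (hζ : 0 < M.zeta) (τ : ℝ) : (drainIso hζ).symm (M.drain τ) = τ :=
  (drainIso hζ).symm_apply_apply τ

theorem symm_nonneg (hζ : 0 < M.zeta) {y : ℝ} (hy : 0 ≤ y) : 0 ≤ (drainIso hζ).symm y := by
  rw [← (strictMono_drain hζ).le_iff_le, drain_symm, drain_zero]
  exact hy

theorem drain_nonneg (hζ : 0 < M.zeta) {τ : ℝ} (hτ : 0 ≤ τ) : 0 ≤ M.drain τ := by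
  rw [← drain_zero (M := M)]
  exact (strictMono_drain hζ).monotone hτ

/-- Net production equal to minus the drain rate reduces the inventory from `drain τ` to
`drain (τ - t)`. -/
theorem inventory_eq_drain (hζ : 0 < M.zeta) {τ : ℝ} {a q : ℝ → ℝ}
    (h : ∀ᵐ t, t ∈ Ioc 0 τ → a t - q t = -M.drainRate (τ - t)) {t : ℝ} (ht : t ∈ Icc 0 τ) :
    inventory (M.drain τ) a q t = M.drain (τ - t) := by
  have h1 : ∫ s in (0 : ℝ)..t, (a s - q s) = ∫ s in (0 : ℝ)..t, -M.drainRate (τ - s) := by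
    refine intervalIntegral.integral_congr_ae ?_
    filter_upwards [h] with s hs hmem
    rw [uIoc_of_le ht.1] at hmem
    exact hs ⟨hmem.1, hmem.2.trans ht.2⟩
  have h2 := drain_sub_drain hζ (sub_nonneg.2 ht.2) (ht.1.trans ht.2)
  rw [inventory, h1, intervalIntegral.integral_neg,
    intervalIntegral.integral_comp_sub_left (fun s => M.drainRate s) τ, sub_zero, ← h2]
  ring

/-- The inventory does not change after the time `τ` if production equals sales. -/
theorem inventory_eq_of_ge {x τ : ℝ} {a q : ℝ → ℝ}
    (hi : IntervalIntegrable (fun t => a t - q t) volume 0 τ)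
    (h : ∀ t, τ < t → a t = q t) {t : ℝ} (ht : τ ≤ t) :
    inventory x a q t = inventory x a q τ := by
  have h0 : ∀ s ∈ uIoc τ t, a s - q s = 0 := by
    intro s hs
    rw [uIoc_of_le ht] at hs
    rw [h s hs.1, sub_self]
  have hi2 : IntervalIntegrable (fun t => a t - q t) volume τ t := by
    refine (intervalIntegrable_const (c := (0 : ℝ))).congr ?_
    intro s hs
    exact (h0 s hs).symm
  have h1 := intervalIntegral.integral_add_adjacent_intervals hi hi2
  have h2 : ∫ s in τ..t, (a s - q s) = 0 := by
    rw [intervalIntegral.integral_congr_ae (g := fun _ => (0 : ℝ))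
      (Eventually.of_forall h0)]
    simp
  rw [inventory, inventory, ← h1, h2, add_zero]

end Firm

/-! ### Rapidly alternating rates -/

/-- The primitive of a periodic function with mean zero, non-increasing over each period, is
non-negative, and it is bounded by the bound of the function. -/
theorem Function.Periodic.primitive_mem_of_antitoneOn {f : ℝ → ℝ} {K : ℝ}
    (hf : Function.Periodic f 1) (hi : ∀ a b, IntervalIntegrable f volume a b)
    (hanti : AntitoneOn f (Ico 0 1)) (h0 : ∫ s in (0 : ℝ)..1, f s = 0) (hK : ∀ s, |f s| ≤ K)
    (s : ℝ) : 0 ≤ ∫ r in (0 : ℝ)..s, f r ∧ ∫ r in (0 : ℝ)..s, f r ≤ K := by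
  have hred : ∫ r in (0 : ℝ)..s, f r = ∫ r in (0 : ℝ)..Int.fract s, f r := by
    have h1 : ∫ r in (0 : ℝ)..(⌊s⌋ : ℝ), f r = 0 := by
      have := hf.intervalIntegral_add_zsmul_eq ⌊s⌋ 0 hi
      simpa [h0] using this
    have h2 : ∫ r in (⌊s⌋ : ℝ)..s, f r = ∫ r in (0 : ℝ)..Int.fract s, f r := by
      have h3 : ∫ r in (0 : ℝ)..Int.fract s, f (r + (⌊s⌋ : ℝ)) = ∫ r in (⌊s⌋ : ℝ)..s, f r := by
        rw [intervalIntegral.integral_comp_add_right (fun r => f r)]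
        simp
      rw [← h3]
      refine intervalIntegral.integral_congr fun r _ => ?_
      simpa using (hf.int_mul ⌊s⌋ r)
    rw [← intervalIntegral.integral_add_adjacent_intervals (hi 0 ⌊s⌋) (hi ⌊s⌋ s), h1, h2, zero_add]
  rw [hred]
  set w := Int.fract s
  have hw0 : 0 ≤ w := Int.fract_nonneg s
  have hw1 : w < 1 := Int.fract_lt_one s
  have hsplit := intervalIntegral.integral_add_adjacent_intervals (hi 0 w) (hi w 1)
  rw [h0] at hsplit
  constructor
  · have hl : w * f w ≤ ∫ r in (0 : ℝ)..w, f r := by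
      have := intervalIntegral.integral_mono_on hw0 (μ := volume) (f := fun _ => f w) (g := f)
        (by simp) (hi 0 w) fun r hr => hanti ⟨hr.1, hr.2.trans_lt hw1⟩ ⟨hw0, hw1⟩ hr.2
      simpa using this
    have hr : ∫ r in w..1, f r ≤ (1 - w) * f w := by
      have := intervalIntegral.integral_mono_on_of_le_Ioo hw1.le (μ := volume) (f := f)
        (g := fun _ => f w) (hi w 1) (by simp)
        fun r hr => hanti ⟨hw0, hw1⟩ ⟨hw0.trans hr.1.le, hr.2⟩ hr.1.le
      simpa using this
    rcases le_total 0 (f w) with h | h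
    · exact (mul_nonneg hw0 h).trans hl
    · have := mul_nonpos_of_nonneg_of_nonpos (sub_nonneg.2 hw1.le) h
      linarith
  · have hK0 : 0 ≤ K := (abs_nonneg _).trans (hK 0)
    have := intervalIntegral.integral_mono_on hw0 (μ := volume) (f := f) (g := fun _ => K)
      (hi 0 w) (by simp) fun r _ => (le_abs_self _).trans (hK r)
    simp only [intervalIntegral.integral_const, sub_zero, smul_eq_mul] at this
    nlinarith

/-- The function with period `1` that is `a` on `[0, p)` and `b` on `[p, 1)`. -/
noncomputable def alternate (p a b s : ℝ) : ℝ := if Int.fract s < p then a else b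

theorem alternate_periodic (p a b : ℝ) : Function.Periodic (alternate p a b) 1 := by
  intro s
  simp [alternate, Int.fract_add_one]

theorem measurable_alternate (p a b : ℝ) : Measurable (alternate p a b) :=
  Measurable.ite (measurableSet_lt measurable_fract measurable_const) measurable_const
    measurable_const

theorem alternate_eq_or (p a b s : ℝ) : alternate p a b s = a ∨ alternate p a b s = b := by
  unfold alternate
  split_ifs <;> simp

theorem abs_alternate_le (p a b s : ℝ) : |alternate p a b s| ≤ max |a| |b| := by
  rcases alternate_eq_or p a b s with h | h <;> rw [h]
  exacts [le_max_left _ _, le_max_right _ _]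

theorem intervalIntegrable_alternate (p a b c d : ℝ) :
    IntervalIntegrable (alternate p a b) volume c d := by
  refine (intervalIntegrable_const (c := max |a| |b|)).mono_fun'
    (measurable_alternate p a b).aestronglyMeasurable ?_
  exact Eventually.of_forall fun s => abs_alternate_le p a b s

theorem antitoneOn_alternate {p a b : ℝ} (hab : b ≤ a) :
    AntitoneOn (alternate p a b) (Ico 0 1) := by
  intro s hs t ht hst
  rw [alternate, alternate, Int.fract_eq_self.2 hs, Int.fract_eq_self.2 ht]
  split_ifs with h1 h2
  · exact le_rfl
  · exact absurd (hst.trans_lt h1) h2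
  · exact hab
  · exact le_rfl

theorem integral_alternate {p a b : ℝ} (hp : p ∈ Ioo (0 : ℝ) 1) :
    ∫ s in (0 : ℝ)..1, alternate p a b s = p * a + (1 - p) * b := by
  rw [← intervalIntegral.integral_add_adjacent_intervals
    (intervalIntegrable_alternate p a b 0 p) (intervalIntegrable_alternate p a b p 1)]
  have h1 : ∫ s in (0 : ℝ)..p, alternate p a b s = ∫ _ in (0 : ℝ)..p, a := by
    refine intervalIntegral.integral_congr_ae ?_
    filter_upwards [(countable_singleton p).ae_notMem volume] with s hs hmem
    rw [uIoc_of_le hp.1.le] at hmem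
    have hlt : s < p := lt_of_le_of_ne hmem.2 hs
    rw [alternate, Int.fract_eq_self.2 ⟨hmem.1.le, hlt.trans hp.2⟩, if_pos hlt]
  have h2 : ∫ s in p..1, alternate p a b s = ∫ _ in p..1, b := by
    refine intervalIntegral.integral_congr_ae ?_
    filter_upwards [(countable_singleton (1 : ℝ)).ae_notMem volume] with s hs hmem
    rw [uIoc_of_le hp.2.le] at hmem
    have hlt : s < 1 := lt_of_le_of_ne hmem.2 hs
    rw [alternate, Int.fract_eq_self.2 ⟨(hp.1.trans hmem.1).le, hlt⟩, if_neg (not_lt.2 hmem.1.le)]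
  rw [h1, h2]
  simp

/-- Two rates that alternate with a short period `h` and have the same mean differ little in
cumulative terms; if the larger production rate and the smaller sales rate come first in each
period, then cumulative production is never behind. -/
theorem integral_alternate_sub_mem {p₁ p₂ a₁ a₂ b₁ b₂ τ h : ℝ} (hh : 0 < h)
    (hp₁ : p₁ ∈ Ioo (0 : ℝ) 1) (hp₂ : p₂ ∈ Ioo (0 : ℝ) 1) (ha : a₂ ≤ a₁) (hb : b₁ ≤ b₂)
    (hmean : p₁ * a₁ + (1 - p₁) * a₂ = p₂ * b₁ + (1 - p₂) * b₂) (t : ℝ) :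
    0 ≤ ∫ s in τ..t, (alternate p₁ a₁ a₂ ((s - τ) / h) - alternate p₂ b₁ b₂ ((s - τ) / h)) ∧
    ∫ s in τ..t, (alternate p₁ a₁ a₂ ((s - τ) / h) - alternate p₂ b₁ b₂ ((s - τ) / h)) ≤
      h * (max |a₁| |a₂| + max |b₁| |b₂|) := by
  set f : ℝ → ℝ := fun s => alternate p₁ a₁ a₂ s - alternate p₂ b₁ b₂ s with hf
  have hcomp : ∫ s in τ..t, f ((s - τ) / h) = h * ∫ s in (0 : ℝ)..((t - τ) / h), f s := by
    have h1 := intervalIntegral.integral_comp_sub_right (a := τ) (b := t) (fun s => f (s / h)) τ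
    rw [h1, intervalIntegral.integral_comp_div f hh.ne']
    simp
  have hi : ∀ c d, IntervalIntegrable f volume c d := fun c d =>
    (intervalIntegrable_alternate p₁ a₁ a₂ c d).sub (intervalIntegrable_alternate p₂ b₁ b₂ c d)
  have hper : Function.Periodic f 1 := by
    intro s
    simp only [hf, alternate_periodic p₁ a₁ a₂ s, alternate_periodic p₂ b₁ b₂ s]
  have hanti : AntitoneOn f (Ico 0 1) := by
    intro s hs r hr hsr
    have h1 := antitoneOn_alternate (p := p₁) ha hs hr hsr
    have h2 := antitoneOn_alternate (p := p₂) (neg_le_neg hb) hs hr hsr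
    have h3 : ∀ w, alternate p₂ (-b₁) (-b₂) w = -alternate p₂ b₁ b₂ w := by
      intro w; unfold alternate; split_ifs <;> rfl
    rw [h3, h3] at h2
    simp only [hf]
    linarith
  have hzero : ∫ s in (0 : ℝ)..1, f s = 0 := by
    rw [hf, intervalIntegral.integral_sub (intervalIntegrable_alternate _ _ _ _ _)
      (intervalIntegrable_alternate _ _ _ _ _), integral_alternate hp₁, integral_alternate hp₂,
      hmean, sub_self]
  obtain ⟨h1, h2⟩ := hper.primitive_mem_of_antitoneOn hi hanti hzero
    (K := max |a₁| |a₂| + max |b₁| |b₂|)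
    (fun s => (abs_sub _ _).trans (add_le_add (abs_alternate_le _ _ _ _) (abs_alternate_le _ _ _ _)))
    ((t - τ) / h)
  rw [hcomp]
  exact ⟨mul_nonneg hh.le h1, mul_le_mul_of_nonneg_left h2 hh.le⟩

/-! ### Ordinary controls: weak duality and optimality -/

namespace Firm

variable {M : Firm}

/-- A problem with ordinary controls whose revenue and cost obey the inequalities that define `R̂`
and `Ĉ`. Both the original and the convexified problem are of this kind. -/
structure IsDominated (M : Firm) (A Q : Set ℝ) (R C : ℝ → ℝ) : Prop where
  prod_nonneg : ∀ a ∈ A, 0 ≤ a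
  sell_nonneg : ∀ q ∈ Q, 0 ≤ q
  exists_sell_le : ∃ K, ∀ q ∈ Q, q ≤ K
  cost_nonneg : ∀ a ∈ A, 0 ≤ C a
  le_cost : ∀ a ∈ A, ∀ z, z * a - M.Chat z ≤ C a
  revenue_le : ∀ q ∈ Q, ∀ z, R q ≤ M.Rhat z + z * q

theorem isDominated_self (M : Firm) : M.IsDominated M.A M.Q M.R M.C where
  prod_nonneg := M.A_nonneg
  sell_nonneg := M.Q_nonneg
  exists_sell_le := M.Q_compact.bddAbove
  cost_nonneg := M.C_nonneg
  le_cost _ ha z := M.le_C ha z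
  revenue_le _ hq z := M.R_le hq z

theorem isDominated_convexified (M : Firm) : M.IsDominated M.coA M.coQ M.Rtilde M.Ctilde where
  prod_nonneg _ ha := M.coA_nonneg ha
  sell_nonneg _ hq := M.coQ_nonneg hq
  exists_sell_le := by
    obtain ⟨K, -, hK⟩ := M.exists_coQ_le
    exact ⟨K, hK⟩
  cost_nonneg a _ := M.Ctilde_nonneg a
  le_cost _ ha z := M.le_Ctilde ha z
  revenue_le _ hq z := M.Rtilde_le hq z

theorem intervalIntegrable_of_integrableOn_Icc {f : ℝ → ℝ} {T : ℝ} (hT : 0 ≤ T)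
    (h : IntegrableOn f (Icc 0 T)) : IntervalIntegrable f volume 0 T := by
  refine IntegrableOn.intervalIntegrable ?_
  rwa [uIcc_of_le hT]

theorem aestronglyMeasurable_of_measurable_Ici {f : ℝ → ℝ}
    (h : Measurable fun t : Ici (0 : ℝ) => f t) :
    AEStronglyMeasurable f (volume.restrict (Ici 0)) :=
  (aemeasurable_restrict_of_measurable_subtype measurableSet_Ici h).aestronglyMeasurable

namespace IsDominated

variable {A Q : Set ℝ} {R C : ℝ → ℝ}

theorem profit_le_dualValue (h : M.IsDominated A Q R C) (hζ : 0 < M.zeta) {x τ : ℝ} (hτ : 0 ≤ τ)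
    {α q : ℝ → ℝ} (hadm : Admissible A Q x α q) :
    profit M.β R C α q ≤ (M.dualValue τ x : EReal) := by
  obtain ⟨K, hK⟩ := h.exists_sell_le
  refine discounted_sub_le_dualValue hζ hτ (K := K)
    (fun T hT => intervalIntegrable_of_integrableOn_Icc hT (hadm.integrable_prod T hT))
    (aestronglyMeasurable_of_measurable_Ici hadm.measurable_sell) ?_ hadm.inventory_nonneg ?_ ?_
  all_goals
    filter_upwards [ae_restrict_mem measurableSet_Ici] with t ht
  · exact ⟨h.sell_nonneg _ (hadm.mem_sell t ht), hK _ (hadm.mem_sell t ht)⟩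
  · exact ENNReal.ofReal_le_ofReal (h.revenue_le _ (hadm.mem_sell t ht) _)
  · exact ENNReal.ofReal_le_ofReal (h.le_cost _ (hadm.mem_prod t ht) _)

theorem valueFun_le_dualValue (h : M.IsDominated A Q R C) (hζ : 0 < M.zeta) {x τ : ℝ}
    (hτ : 0 ≤ τ) : valueFun M.β A Q R C x ≤ (M.dualValue τ x : EReal) :=
  iSup_le fun _ => iSup_le fun _ => iSup_le fun hadm => h.profit_le_dualValue hζ hτ hadm

/-- Optimal production rates at prices up to `ζ` are bounded. -/
theorem prod_le (h : M.IsDominated A Q R C) {a z : ℝ} (hz : z ≤ M.zeta) (ha : a ∈ A)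
    (he : C a = z * a - M.Chat z) : a ≤ M.Chat (M.zeta + 1) + M.C 0 := by
  refine M.subgradient_Chat_le hz (fun w => ?_) (h.prod_nonneg a ha)
  have := h.le_cost a ha w
  linarith

theorem dualValue_sub_le_profit (h : M.IsDominated A Q R C) (hζ : 0 < M.zeta) {x τ ε : ℝ}
    (hτ : 0 ≤ τ) (hε : 0 ≤ ε) {α q : ℝ → ℝ} (hadm : Admissible A Q x α q)
    (htight : ∀ᵐ t ∂(volume.restrict (Ici (0 : ℝ))),
      C (α t) = M.price τ t * α t - M.Chat (M.price τ t) ∧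
      R (q t) = M.Rhat (M.price τ t) + M.price τ t * q t)
    (hX : ∀ t, τ ≤ t → inventory x α q t ≤ ε) :
    ((M.dualValue τ x - M.zeta * ε : ℝ) : EReal) ≤ profit M.β R C α q := by
  obtain ⟨K, hK⟩ := h.exists_sell_le
  refine dualValue_sub_le_discounted_sub hζ hτ hε (a := α) (q := q)
    (K := max (M.Chat (M.zeta + 1) + M.C 0) K)
    (aestronglyMeasurable_of_measurable_Ici hadm.measurable_prod) ?_
    (aestronglyMeasurable_of_measurable_Ici hadm.measurable_sell) ?_ hX ?_ ?_ ?_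
  all_goals
    filter_upwards [ae_restrict_mem measurableSet_Ici, htight] with t ht hte
  · rw [abs_of_nonneg (h.prod_nonneg _ (hadm.mem_prod t ht))]
    exact le_max_of_le_left (h.prod_le (price_le hζ τ t) (hadm.mem_prod t ht) hte.1)
  · rw [abs_of_nonneg (h.sell_nonneg _ (hadm.mem_sell t ht))]
    exact le_max_of_le_right (hK _ (hadm.mem_sell t ht))
  · rw [hte.2]
  · rw [hte.1]
  · rw [← hte.1]
    exact h.cost_nonneg _ (hadm.mem_prod t ht)

theorem isOptimal_of_tight (h : M.IsDominated A Q R C) (hζ : 0 < M.zeta) {x τ : ℝ}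
    (hτ : 0 ≤ τ) {α q : ℝ → ℝ} (hadm : Admissible A Q x α q)
    (htight : ∀ᵐ t ∂(volume.restrict (Ici (0 : ℝ))),
      C (α t) = M.price τ t * α t - M.Chat (M.price τ t) ∧
      R (q t) = M.Rhat (M.price τ t) + M.price τ t * q t)
    (hX : ∀ t, τ ≤ t → inventory x α q t = 0) : IsOptimal M.β A Q R C x α q := by
  refine ⟨hadm, le_antisymm ?_ ?_⟩
  · exact le_iSup_of_le α (le_iSup_of_le q (le_iSup_of_le hadm le_rfl))
  · refine (h.valueFun_le_dualValue hζ hτ).trans ?_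
    simpa using h.dualValue_sub_le_profit hζ hτ le_rfl hadm htight fun t ht => (hX t ht).le

end IsDominated

/-! ### Feedback controls driven by the shadow price -/

theorem countable_price_mem (hζ : 0 < M.zeta) (τ : ℝ) {S : Set ℝ} (hS : S.Countable) :
    {t | t ≤ τ ∧ M.price τ t ∈ S}.Countable := by
  refine MapsTo.countable_of_injOn (f := M.price τ) (t := S) (fun t ht => ht.2) ?_ hS
  intro s hs t ht hst
  rw [price_of_ge hs.1, price_of_ge ht.1] at hst
  have := Real.exp_injective (mul_left_cancel₀ hζ.ne' hst)
  have := mul_left_cancel₀ (neg_ne_zero.2 M.β_pos.ne') this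
  linarith

theorem measurable_ite_deriv_price {φ : ℝ → ℝ} {τ : ℝ} {g : ℝ → ℝ} (hg : Measurable g) :
    Measurable fun t => if t ≤ τ then deriv φ (M.price τ t) else g t :=
  Measurable.ite measurableSet_Iic
    ((measurable_deriv φ).comp (M.continuous_price τ).measurable) hg

/-- At time `t < τ` the feedback controls given by the derivatives of `Ĉ` and `R̂` deplete the
inventory at the drain rate. -/
theorem deriv_Chat_sub_neg_deriv_Rhat {τ t : ℝ} (ht : t ≤ τ)
    (hR : DifferentiableAt ℝ M.Rhat (M.price τ t))
    (hC : DifferentiableAt ℝ M.Chat (M.price τ t)) :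
    deriv M.Chat (M.price τ t) - (-deriv M.Rhat (M.price τ t)) = -M.drainRate (τ - t) := by
  obtain ⟨-, -, -, -, -, -, -, -, h⟩ := M.optimal_rates hR hC
  rw [h, drainRate, neg_neg, ← price_of_ge ht]

/-- The controls `α`, `q` are up to time `τ`, except on the countable set `S`, those that the two
departments choose at the shadow price. -/
structure IsFeedback (M : Firm) (τ : ℝ) (S : Set ℝ) (α q : ℝ → ℝ) : Prop where
  countable : S.Countable
  diff_Rhat : ∀ t ∈ Icc 0 τ \ S, DifferentiableAt ℝ M.Rhat (M.price τ t)
  diff_Chat : ∀ t ∈ Icc 0 τ \ S, DifferentiableAt ℝ M.Chat (M.price τ t)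
  prod_eq : ∀ t ∈ Icc 0 τ \ S, α t = deriv M.Chat (M.price τ t)
  sell_eq : ∀ t ∈ Icc 0 τ \ S, q t = -deriv M.Rhat (M.price τ t)

namespace IsFeedback

variable {τ : ℝ} {S : Set ℝ} {α q : ℝ → ℝ}

theorem inventory_eq (h : M.IsFeedback τ S α q) (hζ : 0 < M.zeta) {t : ℝ} (ht : t ∈ Icc 0 τ) :
    inventory (M.drain τ) α q t = M.drain (τ - t) := by
  refine inventory_eq_drain hζ ?_ ht
  filter_upwards [h.countable.ae_notMem volume] with s hs hmem
  have hs' : s ∈ Icc 0 τ \ S := ⟨Ioc_subset_Icc_self hmem, hs⟩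
  rw [h.prod_eq s hs', h.sell_eq s hs']
  exact deriv_Chat_sub_neg_deriv_Rhat hmem.2 (h.diff_Rhat s hs') (h.diff_Chat s hs')

theorem intervalIntegrable (h : M.IsFeedback τ S α q) (hζ : 0 < M.zeta) (hτ : 0 ≤ τ) :
    IntervalIntegrable (fun t => α t - q t) volume 0 τ := by
  have hd : IntervalIntegrable (fun t => M.drainRate (τ - t)) volume 0 τ := by
    simpa using (intervalIntegrable_drainRate (M := M) hζ τ 0).comp_sub_left τ
  refine hd.neg.congr_ae ?_
  rw [uIoc_of_le hτ]
  filter_upwards [ae_restrict_mem measurableSet_Ioc, h.countable.ae_notMem _] with s hmem hs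
  have hs' : s ∈ Icc 0 τ \ S := ⟨Ioc_subset_Icc_self hmem, hs⟩
  rw [h.prod_eq s hs', h.sell_eq s hs']
  exact (deriv_Chat_sub_neg_deriv_Rhat hmem.2 (h.diff_Rhat s hs') (h.diff_Chat s hs')).symm

theorem measurable_prod (h : M.IsFeedback τ S α q) {g : ℝ → ℝ} (hg : Measurable g)
    (he : ∀ t, τ < t → α t = g t) : Measurable fun t : Ici (0 : ℝ) => α t := by
  refine ((measurable_ite_deriv_price (M := M) (φ := M.Chat) (τ := τ) hg).comp
    measurable_subtype_coe).measurable_of_countable_ne ?_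
  refine (h.countable.preimage Subtype.coe_injective).mono ?_
  intro t ht
  by_contra hS
  refine ht ?_
  simp only [Function.comp_apply]
  split_ifs with hle
  · exact (h.prod_eq t ⟨⟨t.2, hle⟩, hS⟩).symm
  · exact (he t (not_le.1 hle)).symm

theorem measurable_sell (h : M.IsFeedback τ S α q) {g : ℝ → ℝ} (hg : Measurable g)
    (he : ∀ t, τ < t → q t = g t) : Measurable fun t : Ici (0 : ℝ) => q t := by
  refine ((measurable_ite_deriv_price (M := M) (φ := M.Rhat) (τ := τ) hg.neg).comp
    measurable_subtype_coe).neg.measurable_of_countable_ne ?_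
  refine (h.countable.preimage Subtype.coe_injective).mono ?_
  intro t ht
  by_contra hS
  refine ht ?_
  simp only [Pi.neg_apply, Function.comp_apply]
  split_ifs with hle
  · exact (h.sell_eq t ⟨⟨t.2, hle⟩, hS⟩).symm
  · rw [neg_neg]; exact (he t (not_le.1 hle)).symm

end IsFeedback

/-- Feedback controls up to time `τ`, followed by a measurable strategy that uses optimal rates at
the price `ζ` and keeps the inventory non-negative, form an admissible strategy with optimal rates
at the shadow price. -/
theorem IsFeedback.admissible {A Q : Set ℝ} {R C : ℝ → ℝ} (hdom : M.IsDominated A Q R C)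
    (hζ : 0 < M.zeta) {τ : ℝ} {S : Set ℝ} {α q : ℝ → ℝ}
    (h : M.IsFeedback τ S α q)
    (hrates : ∀ z, DifferentiableAt ℝ M.Rhat z → DifferentiableAt ℝ M.Chat z →
      C (deriv M.Chat z) = z * deriv M.Chat z - M.Chat z ∧
      R (-deriv M.Rhat z) = M.Rhat z + z * (-deriv M.Rhat z))
    (hαA : ∀ t, 0 ≤ t → α t ∈ A) (hqQ : ∀ t, 0 ≤ t → q t ∈ Q)
    {f g : ℝ → ℝ} (hf : Measurable f) (hg : Measurable g)
    (hαf : ∀ t, τ < t → α t = f t) (hqg : ∀ t, τ < t → q t = g t)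
    (htight : ∀ t, τ < t → C (α t) = M.zeta * α t - M.Chat M.zeta ∧
      R (q t) = M.Rhat M.zeta + M.zeta * q t)
    (hX : ∀ t, τ < t → 0 ≤ inventory (M.drain τ) α q t) :
    Admissible A Q (M.drain τ) α q ∧
    ∀ᵐ t ∂(volume.restrict (Ici (0 : ℝ))),
      C (α t) = M.price τ t * α t - M.Chat (M.price τ t) ∧
      R (q t) = M.Rhat (M.price τ t) + M.price τ t * q t := by
  have hae : ∀ᵐ t ∂(volume.restrict (Ici (0 : ℝ))),
      C (α t) = M.price τ t * α t - M.Chat (M.price τ t) ∧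
      R (q t) = M.Rhat (M.price τ t) + M.price τ t * q t := by
    filter_upwards [ae_restrict_mem measurableSet_Ici, h.countable.ae_notMem _] with t ht hS
    rcases le_or_gt t τ with hle | hlt
    · have ht' : t ∈ Icc 0 τ \ S := ⟨⟨ht, hle⟩, hS⟩
      rw [h.prod_eq t ht', h.sell_eq t ht']
      exact hrates _ (h.diff_Rhat t ht') (h.diff_Chat t ht')
    · rw [price_of_le hlt.le]
      exact htight t hlt
  have hmα := h.measurable_prod hf hαf
  refine ⟨⟨hmα, h.measurable_sell hg hqg, hαA, hqQ, ?_, ?_⟩, hae⟩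
  · intro T _
    have hle : volume.restrict (Icc 0 T) ≤ volume.restrict (Ici (0 : ℝ)) :=
      Measure.restrict_mono Icc_subset_Ici_self le_rfl
    refine Integrable.mono' (integrable_const (M.Chat (M.zeta + 1) + M.C 0))
      ((aestronglyMeasurable_of_measurable_Ici hmα).mono_measure hle) (ae_mono hle ?_)
    filter_upwards [ae_restrict_mem measurableSet_Ici, hae] with t ht hte
    rw [Real.norm_eq_abs, abs_of_nonneg (hdom.prod_nonneg _ (hαA t ht))]
    exact hdom.prod_le (price_le hζ τ t) (hαA t ht) hte.1
  · intro t ht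
    rcases le_or_gt t τ with hle | hlt
    · rw [h.inventory_eq hζ ⟨ht, hle⟩]
      exact drain_nonneg hζ (sub_nonneg.2 hle)
    · exact hX t hlt

/-- The inventory is sold out at time `τ` and remains zero if production then equals sales. -/
theorem IsFeedback.inventory_eq_zero {τ : ℝ} {S : Set ℝ} {α q : ℝ → ℝ} (hζ : 0 < M.zeta)
    (hτ : 0 ≤ τ) (h : M.IsFeedback τ S α q) (he : ∀ t, τ < t → α t = q t) {t : ℝ}
    (ht : τ ≤ t) : inventory (M.drain τ) α q t = 0 := by
  rw [inventory_eq_of_ge (h.intervalIntegrable hζ hτ) he ht, h.inventory_eq hζ ⟨hτ, le_rfl⟩, sub_self, drain_zero]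

/-- Feedback controls up to time `τ`, followed by a common rate for production and sales that is
optimal at the price `ζ`, form an optimal strategy. -/
theorem IsFeedback.isOptimal {A Q : Set ℝ} {R C : ℝ → ℝ} (hdom : M.IsDominated A Q R C)
    (hζ : 0 < M.zeta) {τ u : ℝ} (hτ : 0 ≤ τ) {S : Set ℝ} {α q : ℝ → ℝ}
    (h : M.IsFeedback τ S α q)
    (hrates : ∀ z, DifferentiableAt ℝ M.Rhat z → DifferentiableAt ℝ M.Chat z →
      deriv M.Chat z ∈ A ∧ -deriv M.Rhat z ∈ Q ∧
      C (deriv M.Chat z) = z * deriv M.Chat z - M.Chat z ∧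
      R (-deriv M.Rhat z) = M.Rhat z + z * (-deriv M.Rhat z))
    (hS : ∀ t ∈ Icc 0 τ ∩ S, α t ∈ A ∧ q t ∈ Q)
    (huA : u ∈ A) (huQ : u ∈ Q) (huC : C u = M.zeta * u - M.Chat M.zeta)
    (huR : R u = M.Rhat M.zeta + M.zeta * u) (hu : ∀ t, τ < t → α t = u ∧ q t = u) :
    IsOptimal M.β A Q R C (M.drain τ) α q ∧
      ∀ t, τ ≤ t → inventory (M.drain τ) α q t = 0 := by
  have hX : ∀ t, τ ≤ t → inventory (M.drain τ) α q t = 0 := fun t ht =>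
    IsFeedback.inventory_eq_zero hζ hτ h (fun s hs => (hu s hs).1.trans (hu s hs).2.symm) ht
  have hmem : ∀ t, 0 ≤ t → α t ∈ A ∧ q t ∈ Q := by
    intro t ht
    rcases le_or_gt t τ with hle | hlt
    · by_cases htS : t ∈ S
      · exact hS t ⟨⟨ht, hle⟩, htS⟩
      · have ht' : t ∈ Icc 0 τ \ S := ⟨⟨ht, hle⟩, htS⟩
        obtain ⟨h1, h2, -⟩ := hrates _ (h.diff_Rhat t ht') (h.diff_Chat t ht')
        rw [h.prod_eq t ht', h.sell_eq t ht']
        exact ⟨h1, h2⟩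
    · rw [(hu t hlt).1, (hu t hlt).2]
      exact ⟨huA, huQ⟩
  obtain ⟨hadm, htight⟩ := h.admissible hdom hζ (fun z hR hC => (hrates z hR hC).2.2)
    (fun t ht => (hmem t ht).1) (fun t ht => (hmem t ht).2)
    (measurable_const (a := u)) (measurable_const (a := u))
    (fun t ht => (hu t ht).1) (fun t ht => (hu t ht).2)
    (fun t ht => by rw [(hu t ht).1, (hu t ht).2]; exact ⟨huC, huR⟩)
    (fun t ht => (hX t ht.le).ge)
  exact ⟨hdom.isOptimal_of_tight hζ hτ hadm htight hX, hX⟩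

/-! ### The value function -/

/-- Strong duality for the original problem: after selling out, the convexified optimal rates are
imitated by rapidly alternating between rates in the original control sets. -/
theorem exists_admissible_dualValue_sub_le (hζ : 0 < M.zeta) {τ : ℝ} (hτ : 0 ≤ τ) {ε : ℝ}
    (hε : 0 < ε) : ∃ α q, Admissible M.A M.Q (M.drain τ) α q ∧
      ((M.dualValue τ (M.drain τ) - M.zeta * ε : ℝ) : EReal) ≤ profit M.β M.R M.C α q := by
  obtain ⟨u, hu⟩ := M.optStaticConv_nonempty
  obtain ⟨q₁, hq₁, q₂, hq₂, γ, hγ, hq, hRq₁, hRq₂, huq⟩ := M.exists_sell_combo hu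
  obtain ⟨a₁, ha₁, a₂, ha₂, ν, hν, ha, hCa₁, hCa₂, hua⟩ := M.exists_prod_combo hu
  set D : Set ℝ := {z | DifferentiableAt ℝ M.Rhat z ∧ DifferentiableAt ℝ M.Chat z} with hD
  have hDc : Dᶜ.Countable := M.countable_not_differentiableAt
  set K := max |a₂| |a₁| + max |q₁| |q₂| with hK
  have hK0 : 0 ≤ K := add_nonneg (le_max_of_le_left (abs_nonneg _))
    (le_max_of_le_left (abs_nonneg _))
  set h := ε / (K + 1) with hh
  have hh0 : 0 < h := div_pos hε (by linarith)
  have hhK : h * K ≤ ε := by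
    rw [hh, div_mul_eq_mul_div, div_le_iff₀ (by linarith)]
    nlinarith
  have hν' : 1 - ν ∈ Ioo (0 : ℝ) 1 := ⟨by linarith [hν.2], by linarith [hν.1]⟩
  classical
  set f : ℝ → ℝ := fun t => alternate (1 - ν) a₂ a₁ ((t - τ) / h) with hf
  set g : ℝ → ℝ := fun t => alternate γ q₁ q₂ ((t - τ) / h) with hg
  have hsc : Measurable fun t : ℝ => (t - τ) / h := by fun_prop
  have hfm : Measurable f := (measurable_alternate _ _ _).comp hsc
  have hgm : Measurable g := (measurable_alternate _ _ _).comp hsc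
  set α : ℝ → ℝ := fun t => if t ≤ τ then
    (if M.price τ t ∈ D then deriv M.Chat (M.price τ t) else 0) else f t with hα
  set q : ℝ → ℝ := fun t => if t ≤ τ then
    (if M.price τ t ∈ D then -deriv M.Rhat (M.price τ t) else 0) else g t with hq'
  have hαf : ∀ t, τ < t → α t = f t := fun t ht => if_neg (not_le.2 ht)
  have hqg : ∀ t, τ < t → q t = g t := fun t ht => if_neg (not_le.2 ht)
  have hfb : M.IsFeedback τ {t | t ≤ τ ∧ M.price τ t ∈ Dᶜ} α q := by
    have hin : ∀ t ∈ Icc 0 τ \ {t | t ≤ τ ∧ M.price τ t ∈ Dᶜ}, t ≤ τ ∧ M.price τ t ∈ D := by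
      intro t ht
      refine ⟨ht.1.2, ?_⟩
      by_contra hn
      exact ht.2 ⟨ht.1.2, hn⟩
    refine ⟨countable_price_mem hζ τ hDc, fun t ht => (hin t ht).2.1, fun t ht => (hin t ht).2.2,
      fun t ht => ?_, fun t ht => ?_⟩
    · simp only [hα, if_pos (hin t ht).1, if_pos (hin t ht).2]
    · simp only [hq', if_pos (hin t ht).1, if_pos (hin t ht).2]
  have hftight : ∀ t, f t ∈ M.A ∧ M.C (f t) = M.zeta * f t - M.Chat M.zeta := by
    intro t
    rcases alternate_eq_or (1 - ν) a₂ a₁ ((t - τ) / h) with he | he <;> simp only [hf, he]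
    exacts [⟨ha₂, hCa₂⟩, ⟨ha₁, hCa₁⟩]
  have hgtight : ∀ t, g t ∈ M.Q ∧ M.R (g t) = M.Rhat M.zeta + M.zeta * g t := by
    intro t
    rcases alternate_eq_or γ q₁ q₂ ((t - τ) / h) with he | he <;> simp only [hg, he]
    exacts [⟨hq₁, hRq₁⟩, ⟨hq₂, hRq₂⟩]
  have hαA : ∀ t, α t ∈ M.A := by
    intro t
    simp only [hα]
    split_ifs with h1 h2
    · exact (M.optimal_rates h2.1 h2.2).2.2.2.1
    · exact M.zero_mem_A
    · exact (hftight t).1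
  have hqQ : ∀ t, q t ∈ M.Q := by
    intro t
    simp only [hq']
    split_ifs with h1 h2
    · exact (M.optimal_rates h2.1 h2.2).2.2.1
    · exact M.zero_mem_Q
    · exact (hgtight t).1
  -- the inventory after time `τ` is the lead of production over sales since `τ`
  have hinv : ∀ t, τ ≤ t → inventory (M.drain τ) α q t = ∫ s in τ..t, (f s - g s) := by
    intro t ht
    have h1 : inventory (M.drain τ) α q τ = 0 := by
      rw [hfb.inventory_eq hζ ⟨hτ, le_rfl⟩, sub_self, drain_zero]
    have hcongr : ∀ᵐ s, s ∈ uIoc τ t → α s - q s = f s - g s := by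
      refine Eventually.of_forall fun s hs => ?_
      rw [uIoc_of_le ht] at hs
      rw [hαf s hs.1, hqg s hs.1]
    have hifg : IntervalIntegrable (fun s => f s - g s) volume τ t := by
      refine (intervalIntegrable_const (c := K)).mono_fun' (hfm.sub hgm).aestronglyMeasurable ?_
      refine Eventually.of_forall fun s => (abs_sub _ _).trans ?_
      exact add_le_add (abs_alternate_le _ _ _ _) (abs_alternate_le _ _ _ _)
    have hi2 : IntervalIntegrable (fun s => α s - q s) volume τ t := by
      refine hifg.congr ?_
      intro s hs
      rw [uIoc_of_le ht] at hs
      simp only [hαf s hs.1, hqg s hs.1]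
    have h2 := intervalIntegral.integral_add_adjacent_intervals
      (hfb.intervalIntegrable hζ hτ) hi2
    rw [inventory, ← h2, ← intervalIntegral.integral_congr_ae hcongr]
    rw [inventory] at h1
    linarith
  have hmem : ∀ t, τ ≤ t → 0 ≤ inventory (M.drain τ) α q t ∧
      inventory (M.drain τ) α q t ≤ ε := by
    intro t ht
    rw [hinv t ht]
    obtain ⟨h1, h2⟩ := integral_alternate_sub_mem (τ := τ) hh0 hν' hγ ha hq
      (by rw [← huq, hua]; ring) t
    exact ⟨h1, h2.trans hhK⟩
  obtain ⟨hadm, htight⟩ := hfb.admissible M.isDominated_self hζ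
    (fun z hR hC => ⟨(M.optimal_rates hR hC).2.2.2.2.2.1, (M.optimal_rates hR hC).2.2.2.2.1⟩)
    (fun t _ => hαA t) (fun t _ => hqQ t) hfm hgm hαf hqg
    (fun t ht => by rw [hαf t ht, hqg t ht]; exact ⟨(hftight t).2, (hgtight t).2⟩)
    (fun t ht => (hmem t ht.le).1)
  exact ⟨α, q, hadm, M.isDominated_self.dualValue_sub_le_profit hζ hτ hε.le hadm htight
    fun t ht => (hmem t ht).2⟩

theorem value_le_dualValue (hζ : 0 < M.zeta) {x τ : ℝ} (hτ : 0 ≤ τ) :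
    M.value x ≤ (M.dualValue τ x : EReal) :=
  M.isDominated_self.valueFun_le_dualValue hζ hτ

theorem value_drain (hζ : 0 < M.zeta) {τ : ℝ} (hτ : 0 ≤ τ) :
    M.value (M.drain τ) = (M.dualValue τ (M.drain τ) : EReal) := by
  refine le_antisymm (value_le_dualValue hζ hτ) ?_
  refine EReal.ge_of_forall_gt_iff_ge.1 fun c hc => ?_
  rw [EReal.coe_lt_coe_iff] at hc
  obtain ⟨α, q, hadm, hle⟩ := exists_admissible_dualValue_sub_le hζ hτ
    (div_pos (sub_pos.2 hc) hζ)
  rw [mul_div_cancel₀ _ hζ.ne', sub_sub_cancel] at hle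
  exact hle.trans (le_iSup_of_le α (le_iSup_of_le q (le_iSup_of_le hadm le_rfl)))

theorem value_eq (hζ : 0 < M.zeta) {y : ℝ} (hy : 0 ≤ y) :
    M.value y = (M.dualValue ((drainIso hζ).symm y) y : EReal) := by
  have := value_drain hζ (symm_nonneg hζ hy)
  rwa [drain_symm] at this

theorem v_eq (hζ : 0 < M.zeta) {y : ℝ} (hy : 0 ≤ y) :
    M.v y = M.dualValue ((drainIso hζ).symm y) y := by
  rw [v, value_eq hζ hy, EReal.toReal_coe]

theorem v_le (hζ : 0 < M.zeta) {y τ : ℝ} (hy : 0 ≤ y) (hτ : 0 ≤ τ) :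
    M.v y ≤ M.dualValue τ y := by
  have := value_le_dualValue hζ (x := y) hτ
  rw [value_eq hζ hy, EReal.coe_le_coe_iff] at this
  rwa [v_eq hζ hy]

/-- The value function is the lower envelope of the dual objectives, which are affine in the
inventory. So it has the initial shadow price as a supergradient, which depends continuously on
the inventory; hence this is the derivative. -/
theorem hasDerivWithinAt_v (hζ : 0 < M.zeta) {x : ℝ} (hx : 0 ≤ x) :
    HasDerivWithinAt M.v (M.zeta * Real.exp (-M.β * (drainIso hζ).symm x)) (Ici 0) x := by
  set p : ℝ → ℝ := fun y => M.zeta * Real.exp (-M.β * (drainIso hζ).symm y) with hp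
  have hpc : Continuous p := by
    have := (drainIso hζ).symm.continuous
    fun_prop
  have hsuper : ∀ {y z : ℝ}, 0 ≤ y → 0 ≤ z → M.v z ≤ M.v y + p y * (z - y) := by
    intro y z hy hz
    have h1 := v_le hζ hz (symm_nonneg hζ hy)
    rw [v_eq hζ hy]
    simp only [dualValue, hp] at h1 ⊢
    linarith
  rw [hasDerivWithinAt_iff_tendsto_slope]
  have hlim : Tendsto (fun y => |p y - p x|) (𝓝[Ici 0 \ {x}] x) (𝓝 0) := by
    have : Continuous fun y => |p y - p x| := (hpc.sub continuous_const).abs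
    have h0 := this.tendsto x
    simp only [sub_self, abs_zero] at h0
    exact h0.mono_left nhdsWithin_le_nhds
  rw [tendsto_iff_norm_sub_tendsto_zero]
  refine squeeze_zero' (Eventually.of_forall fun _ => norm_nonneg _) ?_ hlim
  filter_upwards [self_mem_nhdsWithin] with y hy
  have hy0 : 0 ≤ y := hy.1
  have hyx : y ≠ x := hy.2
  have h1 := hsuper hx hy0
  have h2 := hsuper hy0 hx
  have hsl : slope M.v x y * (y - x) = M.v y - M.v x := by
    rw [slope_def_field, div_mul_cancel₀ _ (sub_ne_zero.2 hyx)]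
  show |slope M.v x y - p x| ≤ |p y - p x|
  rcases lt_or_gt_of_ne hyx with hlt | hlt
  · have e1 : p x ≤ slope M.v x y := by nlinarith
    have e2 : slope M.v x y ≤ p y := by nlinarith
    exact abs_le_abs_of_nonneg (by linarith) (by linarith)
  · have e1 : slope M.v x y ≤ p x := by nlinarith
    have e2 : p y ≤ slope M.v x y := by nlinarith
    rw [abs_sub_comm, abs_sub_comm (p y)]
    exact abs_le_abs_of_nonneg (by linarith) (by linarith)

theorem dv_eq (hζ : 0 < M.zeta) {x : ℝ} (hx : 0 ≤ x) :
    M.dv x = M.zeta * Real.exp (-M.β * (drainIso hζ).symm x) :=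
  (hasDerivWithinAt_v hζ hx).derivWithin (uniqueDiffOn_Ici 0 x hx)

theorem tau_eq (hζ : 0 < M.zeta) {x : ℝ} (hx : 0 ≤ x) :
    M.tau x = (drainIso hζ).symm x := by
  have h0 : (drainIso hζ).symm 0 = 0 := by
    have := symm_drain hζ 0
    rwa [drain_zero] at this
  have hβ := M.β_pos.ne'
  rw [tau, dv_eq hζ hx, dv_eq hζ le_rfl, h0, mul_zero, Real.exp_zero, mul_one,
    div_mul_cancel_left₀ hζ.ne', ← Real.exp_neg, Real.log_exp]
  field_simp

end Firm

/-! ### Relaxed controls -/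

theorem IsProbOn.ae_mem {G : Set ℝ} {m : Measure ℝ} (h : IsProbOn G m) : ∀ᵐ y ∂m, y ∈ G :=
  h.2

theorem relaxedInventory_eq (x : ℝ) (α q : ℝ → Measure ℝ) (t : ℝ) :
    relaxedInventory x α q t = inventory x (fun s => ∫ y, y ∂(α s)) (fun s => ∫ y, y ∂(q s)) t :=
  rfl

theorem IsProbOn.integral_eq_toReal {G : Set ℝ} {m : Measure ℝ} (h : IsProbOn G m)
    (hG : ∀ a ∈ G, 0 ≤ a) : ∫ y, y ∂m = (∫⁻ y, ENNReal.ofReal y ∂m).toReal :=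
  integral_eq_lintegral_of_nonneg_ae (h.ae_mem.mono fun y hy => hG y hy)
    measurable_id.aestronglyMeasurable

theorem IsRelaxedControl.measurable_integral_min {G : Set ℝ} {m : ℝ → Measure ℝ}
    (h : IsRelaxedControl G m) (K : ℝ) :
    Measurable fun t : Ici (0 : ℝ) => ∫ y, max 0 (min y K) ∂(m t) := by
  refine h.measurable (fun y => max 0 (min y K)) (by fun_prop) ⟨|K|, fun y => ?_⟩
  rw [abs_of_nonneg (le_max_left _ _)]
  exact max_le (abs_nonneg _) ((min_le_right _ _).trans (le_abs_self _))

/-- The mean rate of a relaxed control, as an extended non-negative number, is measurable in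
time: it is the limit of the means of truncations. -/
theorem IsRelaxedControl.measurable_lintegral {G : Set ℝ} {m : ℝ → Measure ℝ}
    (h : IsRelaxedControl G m) :
    Measurable fun t : Ici (0 : ℝ) => ∫⁻ y, ENNReal.ofReal y ∂(m t) := by
  refine measurable_of_tendsto_metrizable
    (f := fun (n : ℕ) (t : Ici (0 : ℝ)) => ENNReal.ofReal (∫ y, max 0 (min y n) ∂(m t)))
    (fun n => (h.measurable_integral_min n).ennreal_ofReal) ?_
  rw [tendsto_pi_nhds]
  intro t
  have hprob : IsProbabilityMeasure (m t) := (h.prob t t.2).1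
  have hmeas : ∀ n : ℕ, Measurable fun y : ℝ => max 0 (min y (n : ℝ)) := fun n => by fun_prop
  have h1 : ∀ n : ℕ, ENNReal.ofReal (∫ y, max 0 (min y n) ∂(m t)) =
      ∫⁻ y, ENNReal.ofReal (max 0 (min y n)) ∂(m t) := by
    intro n
    refine ofReal_integral_eq_lintegral_ofReal ?_ (Eventually.of_forall fun y => le_max_left _ _)
    refine Integrable.mono' (integrable_const (n : ℝ)) (hmeas n).aestronglyMeasurable
      (Eventually.of_forall fun y => ?_)
    rw [Real.norm_eq_abs, abs_of_nonneg (le_max_left _ _)]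
    exact max_le n.cast_nonneg (min_le_right _ _)
  simp only [h1]
  refine lintegral_tendsto_of_tendsto_of_monotone
    (fun n => (hmeas n).ennreal_ofReal.aemeasurable) (Eventually.of_forall fun y => ?_)
    (Eventually.of_forall fun y => ?_)
  · intro n k hnk
    exact ENNReal.ofReal_le_ofReal (max_le_max le_rfl (min_le_min le_rfl (Nat.cast_le.2 hnk)))
  · refine tendsto_const_nhds.congr' ?_
    filter_upwards [eventually_ge_atTop ⌈y⌉₊] with n hn
    have hy : y ≤ n := (Nat.le_ceil y).trans (Nat.cast_le.2 hn)
    rw [min_eq_left hy, ENNReal.ofReal_max, ENNReal.ofReal_zero, max_eq_right (zero_le)]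

namespace Firm

variable {M : Firm}

theorem integral_sell_mem {m : Measure ℝ} (hm : IsProbOn M.Q m) {K : ℝ}
    (hK : ∀ q ∈ M.Q, q ≤ K) : Integrable (fun y => y) m ∧ 0 ≤ ∫ y, y ∂m ∧ ∫ y, y ∂m ≤ K := by
  have hprob := hm.1
  have hint : Integrable (fun y => y) m := by
    refine Integrable.mono' (integrable_const K) measurable_id.aestronglyMeasurable ?_
    filter_upwards [hm.ae_mem] with y hy
    rw [Real.norm_eq_abs, abs_of_nonneg (M.Q_nonneg y hy)]
    exact hK y hy
  refine ⟨hint, integral_nonneg_of_ae (hm.ae_mem.mono fun y hy => M.Q_nonneg y hy), ?_⟩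
  have := integral_mono_ae hint (integrable_const K) (hm.ae_mem.mono fun y hy => hK y hy)
  simpa using this

theorem lintegral_revenue_le {m : Measure ℝ} (hm : IsProbOn M.Q m) {z : ℝ} (hz : 0 ≤ z) :
    ∫⁻ y, ENNReal.ofReal (M.R y) ∂m ≤ ENNReal.ofReal (M.Rhat z + z * ∫ y, y ∂m) := by
  have hprob := hm.1
  obtain ⟨K, hK⟩ := M.Q_compact.bddAbove
  obtain ⟨hint, -, -⟩ := integral_sell_mem hm (fun q hq => hK hq)
  have hint2 : Integrable (fun y => M.Rhat z + z * y) m :=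
    (integrable_const _).add (hint.const_mul z)
  have he : ∫ y, (M.Rhat z + z * y) ∂m = M.Rhat z + z * ∫ y, y ∂m := by
    rw [integral_add (integrable_const _) (hint.const_mul z), integral_const_mul]
    simp
  rw [← he, ofReal_integral_eq_lintegral_ofReal hint2 (hm.ae_mem.mono fun y hy =>
    add_nonneg (M.Rhat_nonneg z) (mul_nonneg hz (M.Q_nonneg y hy)))]
  exact lintegral_mono_ae (hm.ae_mem.mono fun y hy => ENNReal.ofReal_le_ofReal (M.R_le hy z))

/-- The mean is allowed to be infinite: then it is read as `0`, but the cost is infinite too. -/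
theorem le_lintegral_cost {m : Measure ℝ} (hm : IsProbOn M.A m) {z : ℝ} (hz : 0 < z) :
    ENNReal.ofReal (z * (∫ y, y ∂m) - M.Chat z) ≤ ∫⁻ y, ENNReal.ofReal (M.C y) ∂m := by
  have hprob := hm.1
  by_cases htop : ∫⁻ y, ENNReal.ofReal (M.C y) ∂m = ⊤
  · rw [htop]; exact le_top
  -- finite expected cost forces a finite mean
  have hfin : ∫⁻ y, ENNReal.ofReal (z * y) ∂m < ⊤ := by
    have h1 : ∫⁻ y, ENNReal.ofReal (z * y) ∂m ≤
        ∫⁻ y, (ENNReal.ofReal (M.C y) + ENNReal.ofReal |M.Chat z|) ∂m := by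
      refine lintegral_mono_ae (hm.ae_mem.mono fun y hy => ?_)
      rw [← ENNReal.ofReal_add (M.C_nonneg y hy) (abs_nonneg _)]
      refine ENNReal.ofReal_le_ofReal ?_
      have := M.le_C hy z
      have := le_abs_self (M.Chat z)
      linarith
    refine h1.trans_lt ?_
    rw [lintegral_add_right _ measurable_const, lintegral_const, measure_univ, mul_one]
    exact ENNReal.add_lt_top.2 ⟨lt_top_iff_ne_top.2 htop, ENNReal.ofReal_lt_top⟩
  have hint : Integrable (fun y => z * y) m := by
    have hzm : AEStronglyMeasurable (fun y : ℝ => z * y) m :=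
      (measurable_const_mul z).aestronglyMeasurable
    refine ⟨hzm, ?_⟩
    rw [hasFiniteIntegral_iff_ofReal (hm.ae_mem.mono fun y hy =>
      mul_nonneg hz.le (M.A_nonneg y hy))]
    exact hfin
  have he : ∫ y, (z * y - M.Chat z) ∂m = z * (∫ y, y ∂m) - M.Chat z := by
    rw [integral_sub hint (integrable_const _), integral_const_mul]
    simp
  rw [← he]
  refine (ofReal_integral_le_lintegral (hint.sub (integrable_const _))).trans ?_
  exact lintegral_mono_ae (hm.ae_mem.mono fun y hy => ENNReal.ofReal_le_ofReal (M.le_C hy z))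

theorem aestronglyMeasurable_mean_sell {q : ℝ → Measure ℝ} (hq : IsRelaxedControl M.Q q) :
    AEStronglyMeasurable (fun t => ∫ y, y ∂(q t)) (volume.restrict (Ici 0)) := by
  obtain ⟨K, hK⟩ := M.Q_compact.bddAbove
  refine aestronglyMeasurable_of_measurable_Ici ?_
  convert hq.measurable_integral_min K using 2 with t
  refine integral_congr_ae ((hq.prob t t.2).ae_mem.mono fun y hy => ?_)
  simp only
  rw [min_eq_left (hK hy), max_eq_right (M.Q_nonneg y hy)]

theorem integrableOn_mean_prod {x : ℝ} {α q : ℝ → Measure ℝ}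
    (h : RelaxedAdmissible M.A M.Q x α q) {T : ℝ} (hT : 0 ≤ T) :
    IntegrableOn (fun t => ∫ y, y ∂(α t)) (Icc 0 T) := by
  have hm : AEMeasurable (fun t => ∫⁻ y, ENNReal.ofReal y ∂(α t)) (volume.restrict (Icc 0 T)) :=
    (aemeasurable_restrict_of_measurable_subtype measurableSet_Ici
      h.control_prod.measurable_lintegral).mono_measure
      (Measure.restrict_mono Icc_subset_Ici_self le_rfl)
  refine (integrable_toReal_of_lintegral_ne_top hm (h.finite_prod T hT).ne).congr ?_
  filter_upwards [ae_restrict_mem measurableSet_Icc] with t ht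
  exact ((h.control_prod.prob t ht.1).integral_eq_toReal M.A_nonneg).symm

theorem relaxedProfit_le_dualValue (hζ : 0 < M.zeta) {x τ : ℝ} (hτ : 0 ≤ τ)
    {α q : ℝ → Measure ℝ} (h : RelaxedAdmissible M.A M.Q x α q) :
    relaxedProfit M.β M.R M.C α q ≤ (M.dualValue τ x : EReal) := by
  obtain ⟨K, hK⟩ := M.Q_compact.bddAbove
  refine discounted_sub_le_dualValue hζ hτ (K := K) (a := fun t => ∫ y, y ∂(α t))
    (q := fun t => ∫ y, y ∂(q t))
    (fun T hT => intervalIntegrable_of_integrableOn_Icc hT (integrableOn_mean_prod h hT))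
    (aestronglyMeasurable_mean_sell h.control_sell) ?_ h.inventory_nonneg ?_ ?_
  all_goals
    filter_upwards [ae_restrict_mem measurableSet_Ici] with t ht
  · exact (integral_sell_mem (h.control_sell.prob t ht) fun q hq => hK hq).2
  · exact lintegral_revenue_le (h.control_sell.prob t ht) (price_pos hζ τ t).le
  · exact le_lintegral_cost (h.control_prod.prob t ht) (price_pos hζ τ t)

end Firm

theorem isProbOn_dirac {G : Set ℝ} {a : ℝ} (ha : a ∈ G) : IsProbOn G (Measure.dirac a) :=
  ⟨inferInstance, by simp [Measure.dirac_apply, ha]⟩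

theorem lintegral_twoPoint {p a b : ℝ} (f : ℝ → ℝ≥0∞) :
    ∫⁻ y, f y ∂(twoPoint p a b) = ENNReal.ofReal p * f a + ENNReal.ofReal (1 - p) * f b := by
  rw [twoPoint, lintegral_add_measure, lintegral_smul_measure, lintegral_smul_measure,
    lintegral_dirac, lintegral_dirac, smul_eq_mul, smul_eq_mul]

theorem integral_twoPoint {p a b : ℝ} (hp : p ∈ Ioo (0 : ℝ) 1) (f : ℝ → ℝ) :
    ∫ y, f y ∂(twoPoint p a b) = p * f a + (1 - p) * f b := by
  have hi : ∀ c : ℝ, Integrable f (Measure.dirac c) := fun c =>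
    integrable_dirac (by simp)
  rw [twoPoint, integral_add_measure ((hi a).smul_measure ENNReal.ofReal_ne_top)
    ((hi b).smul_measure ENNReal.ofReal_ne_top), integral_smul_measure, integral_smul_measure,
    integral_dirac, integral_dirac, ENNReal.toReal_ofReal hp.1.le,
    ENNReal.toReal_ofReal (by linarith [hp.2]), smul_eq_mul, smul_eq_mul]

theorem isProbOn_twoPoint {G : Set ℝ} {p a b : ℝ} (hp : p ∈ Ioo (0 : ℝ) 1) (ha : a ∈ G)
    (hb : b ∈ G) : IsProbOn G (twoPoint p a b) := by
  refine ⟨⟨?_⟩, ?_⟩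
  · simp only [twoPoint, Measure.coe_add, Measure.coe_smul, Pi.add_apply, Pi.smul_apply,
      measure_univ, smul_eq_mul, mul_one]
    rw [← ENNReal.ofReal_add hp.1.le (by linarith [hp.2])]
    simp
  · simp [twoPoint, Measure.dirac_apply, ha, hb]

theorem lintegral_ofReal_twoPoint {p a b : ℝ} (hp : p ∈ Ioo (0 : ℝ) 1) {f : ℝ → ℝ}
    (ha : 0 ≤ f a) (hb : 0 ≤ f b) :
    ∫⁻ y, ENNReal.ofReal (f y) ∂(twoPoint p a b) = ENNReal.ofReal (p * f a + (1 - p) * f b) := by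
  have h1 : 0 ≤ 1 - p := by linarith [hp.2]
  rw [lintegral_twoPoint, ENNReal.ofReal_add (mul_nonneg hp.1.le ha) (mul_nonneg h1 hb),
    ENNReal.ofReal_mul hp.1.le, ENNReal.ofReal_mul h1]

namespace Firm

variable {M : Firm}

/-- A relaxed control that consists of Dirac measures at a measurable function up to time `τ`,
except at countably many times, and is constant afterwards. -/
theorem isRelaxedControl_of_dirac {G S : Set ℝ} {m : ℝ → Measure ℝ} {f : ℝ → ℝ} {μ : Measure ℝ}
    {τ : ℝ} (hS : S.Countable) (hf : Measurable f)
    (hm : ∀ t ∈ Icc 0 τ \ S, m t = Measure.dirac (f t)) (hμ : ∀ t, τ < t → m t = μ)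
    (hp : ∀ t, 0 ≤ t → IsProbOn G (m t)) : IsRelaxedControl G m := by
  refine ⟨hp, fun φ hφ _ => ?_⟩
  have hbase : Measurable fun t => if t ≤ τ then φ (f t) else ∫ y, φ y ∂μ :=
    Measurable.ite measurableSet_Iic (hφ.measurable.comp hf) measurable_const
  refine (hbase.comp measurable_subtype_coe).measurable_of_countable_ne
    ((hS.preimage Subtype.coe_injective).mono ?_)
  intro t ht
  by_contra hn
  refine ht ?_
  simp only [Function.comp_apply]
  split_ifs with hle
  · rw [hm t ⟨⟨t.2, hle⟩, hn⟩, integral_dirac]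
  · rw [hμ t (not_le.1 hle)]

/-- Dirac measures at the feedback controls up to time `τ`, followed by a constant pair of
probability measures that represent the convexified optimal rate `u` at the price `ζ`, form an
optimal relaxed strategy. -/
theorem isRelaxedOptimal_of_feedback (hζ : 0 < M.zeta) {τ u : ℝ} (hτ : 0 ≤ τ)
    {S : Set ℝ} {α q : ℝ → Measure ℝ} {f g : ℝ → ℝ} (hfb : M.IsFeedback τ S f g)
    (hα : ∀ t ∈ Icc 0 τ \ S, α t = Measure.dirac (f t))
    (hq : ∀ t ∈ Icc 0 τ \ S, q t = Measure.dirac (g t))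
    (hprob : ∀ t ∈ Icc 0 τ ∩ S, IsProbOn M.A (α t) ∧ IsProbOn M.Q (q t))
    {μ ν : Measure ℝ} (hμ : IsProbOn M.A μ) (hν : IsProbOn M.Q ν)
    (hμu : ∫ y, y ∂μ = u) (hνu : ∫ y, y ∂ν = u)
    (hμC : ∫⁻ y, ENNReal.ofReal (M.C y) ∂μ = ENNReal.ofReal (M.zeta * u - M.Chat M.zeta))
    (hνR : ∫⁻ y, ENNReal.ofReal (M.R y) ∂ν = ENNReal.ofReal (M.Rhat M.zeta + M.zeta * u))
    (hμint : ∫⁻ y, ENNReal.ofReal y ∂μ < ⊤)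
    (hu0 : 0 ≤ M.zeta * u - M.Chat M.zeta)
    (hend : ∀ t, τ < t → α t = μ ∧ q t = ν) :
    IsRelaxedOptimal M.β M.A M.Q M.R M.C (M.drain τ) α q := by
  set a : ℝ → ℝ := fun t => ∫ y, y ∂(α t) with ha
  set b : ℝ → ℝ := fun t => ∫ y, y ∂(q t) with hb
  have haf : ∀ t ∈ Icc 0 τ \ S, a t = f t := fun t ht => by
    simp only [ha, hα t ht, integral_dirac]
  have hbg : ∀ t ∈ Icc 0 τ \ S, b t = g t := fun t ht => by
    simp only [hb, hq t ht, integral_dirac]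
  have hau : ∀ t, τ < t → a t = u := fun t ht => by simp only [ha, (hend t ht).1, hμu]
  have hbu : ∀ t, τ < t → b t = u := fun t ht => by simp only [hb, (hend t ht).2, hνu]
  have hfb' : M.IsFeedback τ S a b :=
    ⟨hfb.countable, hfb.diff_Rhat, hfb.diff_Chat,
      fun t ht => (haf t ht).trans (hfb.prod_eq t ht),
      fun t ht => (hbg t ht).trans (hfb.sell_eq t ht)⟩
  have hX0 : ∀ t, τ ≤ t → inventory (M.drain τ) a b t = 0 := fun t ht =>
    IsFeedback.inventory_eq_zero hζ hτ hfb' (fun s hs => (hau s hs).trans (hbu s hs).symm) ht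
  have hpα : ∀ t, 0 ≤ t → IsProbOn M.A (α t) := by
    intro t ht
    rcases le_or_gt t τ with hle | hlt
    · by_cases htS : t ∈ S
      · exact (hprob t ⟨⟨ht, hle⟩, htS⟩).1
      · have ht' : t ∈ Icc 0 τ \ S := ⟨⟨ht, hle⟩, htS⟩
        rw [hα t ht', hfb.prod_eq t ht']
        exact isProbOn_dirac
          (M.optimal_rates (hfb.diff_Rhat t ht') (hfb.diff_Chat t ht')).2.2.2.1
    · rw [(hend t hlt).1]; exact hμ
  have hpq : ∀ t, 0 ≤ t → IsProbOn M.Q (q t) := by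
    intro t ht
    rcases le_or_gt t τ with hle | hlt
    · by_cases htS : t ∈ S
      · exact (hprob t ⟨⟨ht, hle⟩, htS⟩).2
      · have ht' : t ∈ Icc 0 τ \ S := ⟨⟨ht, hle⟩, htS⟩
        rw [hq t ht', hfb.sell_eq t ht']
        exact isProbOn_dirac
          (M.optimal_rates (hfb.diff_Rhat t ht') (hfb.diff_Chat t ht')).2.2.1
    · rw [(hend t hlt).2]; exact hν
  have hcα : IsRelaxedControl M.A α := by
    refine isRelaxedControl_of_dirac hfb.countable (f := fun t => deriv M.Chat (M.price τ t))
      ((measurable_deriv _).comp (M.continuous_price τ).measurable) (fun t ht => ?_)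
      (fun t ht => (hend t ht).1) hpα
    rw [hα t ht, hfb.prod_eq t ht]
  have hcq : IsRelaxedControl M.Q q := by
    refine isRelaxedControl_of_dirac hfb.countable (f := fun t => -deriv M.Rhat (M.price τ t))
      ((measurable_deriv _).comp (M.continuous_price τ).measurable).neg (fun t ht => ?_)
      (fun t ht => (hend t ht).2) hpq
    rw [hq t ht, hfb.sell_eq t ht]
  set L := M.Chat (M.zeta + 1) + M.C 0 with hL
  have hfL : ∀ t ∈ Icc 0 τ \ S, f t ∈ M.A ∧ M.C (f t) = M.price τ t * f t - M.Chat (M.price τ t) ∧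
      M.R (g t) = M.Rhat (M.price τ t) + M.price τ t * g t ∧ f t ≤ L := by
    intro t ht
    obtain ⟨-, -, -, h4, h5, h6, -⟩ := M.optimal_rates (hfb.diff_Rhat t ht) (hfb.diff_Chat t ht)
    rw [hfb.prod_eq t ht, hfb.sell_eq t ht]
    exact ⟨h4, h6, h5, M.isDominated_self.prod_le (price_le hζ τ t) h4 h6⟩
  have hadm : RelaxedAdmissible M.A M.Q (M.drain τ) α q := by
    refine ⟨hcα, hcq, fun T hT => ?_, fun t ht => ?_⟩
    · have hle : ∫⁻ t in Icc 0 T, (∫⁻ y, ENNReal.ofReal y ∂(α t)) ≤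
          ∫⁻ _ in Icc 0 T, max (ENNReal.ofReal L) (∫⁻ y, ENNReal.ofReal y ∂μ) := by
        refine lintegral_mono_ae ?_
        filter_upwards [ae_restrict_mem measurableSet_Icc, hfb.countable.ae_notMem _] with t ht hS
        rcases le_or_gt t τ with hle | hlt
        · have ht' : t ∈ Icc 0 τ \ S := ⟨⟨ht.1, hle⟩, hS⟩
          rw [hα t ht', lintegral_dirac]
          exact le_max_of_le_left (ENNReal.ofReal_le_ofReal (hfL t ht').2.2.2)
        · rw [(hend t hlt).1]
          exact le_max_right _ _
      refine hle.trans_lt ?_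
      rw [lintegral_const]
      refine ENNReal.mul_lt_top (max_lt ENNReal.ofReal_lt_top hμint) ?_
      simp
    · rw [relaxedInventory_eq]
      rcases le_or_gt t τ with hle | hlt
      · exact (hfb'.inventory_eq hζ ⟨ht, hle⟩).symm ▸ drain_nonneg hζ (sub_nonneg.2 hle)
      · exact (hX0 t hlt.le).ge
  refine ⟨hadm, le_antisymm ?_ ?_⟩
  · exact le_iSup_of_le α (le_iSup_of_le q (le_iSup_of_le hadm le_rfl))
  have hup : relaxedValueFun M.β M.A M.Q M.R M.C (M.drain τ) ≤ (M.dualValue τ (M.drain τ) : EReal) :=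
    iSup_le fun _ => iSup_le fun _ => iSup_le fun h => relaxedProfit_le_dualValue hζ hτ h
  refine hup.trans ?_
  obtain ⟨K, hK⟩ := M.Q_compact.bddAbove
  have htight : ∀ᵐ t ∂(volume.restrict (Ici (0 : ℝ))),
      (0 ≤ a t ∧ a t ≤ max L u ∧ 0 ≤ M.price τ t * a t - M.Chat (M.price τ t)) ∧
      ∫⁻ y, ENNReal.ofReal (M.C y) ∂(α t) =
        ENNReal.ofReal (M.price τ t * a t - M.Chat (M.price τ t)) ∧
      ∫⁻ y, ENNReal.ofReal (M.R y) ∂(q t) =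
        ENNReal.ofReal (M.Rhat (M.price τ t) + M.price τ t * b t) := by
    filter_upwards [ae_restrict_mem measurableSet_Ici, hfb.countable.ae_notMem _] with t ht hS
    rcases le_or_gt t τ with hle | hlt
    · have ht' : t ∈ Icc 0 τ \ S := ⟨⟨ht, hle⟩, hS⟩
      obtain ⟨h1, h2, h3, h4⟩ := hfL t ht'
      rw [haf t ht', hbg t ht', hα t ht', hq t ht', lintegral_dirac, lintegral_dirac, ← h2, ← h3]
      exact ⟨⟨M.A_nonneg _ h1, le_max_of_le_left h4, M.C_nonneg _ h1⟩, rfl, rfl⟩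
    · rw [hau t hlt, hbu t hlt, (hend t hlt).1, (hend t hlt).2, price_of_le hlt.le]
      refine ⟨⟨?_, le_max_right _ _, hu0⟩, hμC, hνR⟩
      rw [← hμu]
      exact integral_nonneg_of_ae (hμ.ae_mem.mono fun y hy => M.A_nonneg y hy)
  have hfin := dualValue_sub_le_discounted_sub hζ hτ (le_refl (0 : ℝ)) (x := M.drain τ)
    (a := a) (q := b) (K := max (max L u) K)
    (r := fun t => ∫⁻ y, ENNReal.ofReal (M.R y) ∂(q t))
    (c := fun t => ∫⁻ y, ENNReal.ofReal (M.C y) ∂(α t))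
    (aestronglyMeasurable_of_measurable_Ici (hfb'.measurable_prod (measurable_const (a := u)) hau))
    (by filter_upwards [htight] with t ht
        rw [abs_of_nonneg ht.1.1]
        exact le_max_of_le_left ht.1.2.1)
    (aestronglyMeasurable_mean_sell hcq)
    (by filter_upwards [ae_restrict_mem measurableSet_Ici] with t ht
        obtain ⟨-, h1, h2⟩ := integral_sell_mem (hpq t ht) fun q hq => hK hq
        rw [abs_of_nonneg h1]
        exact le_max_of_le_right h2)
    (fun t ht => (hX0 t ht).le)
    (by filter_upwards [htight] with t ht using ht.2.2.ge)
    (by filter_upwards [htight] with t ht using ht.2.1.le)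
    (by filter_upwards [htight] with t ht using ht.1.2.2)
  rwa [mul_zero, sub_zero] at hfin

end Firm

/-! ### The sell-out path -/

namespace Firm

variable {M : Firm}

theorem drain_tau (hζ : 0 < M.zeta) {x : ℝ} (hx : 0 ≤ x) : M.drain (M.tau x) = x := by
  rw [tau_eq hζ hx, drain_symm]

theorem tau_pos (hζ : 0 < M.zeta) {x : ℝ} (hx : 0 < x) : 0 < M.tau x := by
  rw [← (strictMono_drain hζ).lt_iff_lt, drain_tau hζ hx.le, drain_zero]
  exact hx

theorem dv_mul_exp (hζ : 0 < M.zeta) {x t : ℝ} (hx : 0 ≤ x) (ht : t ≤ M.tau x) :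
    M.dv x * Real.exp (M.β * t) = M.price (M.tau x) t := by
  rw [price_of_ge ht, dv_eq hζ hx, ← tau_eq hζ hx, mul_assoc, ← Real.exp_add]
  ring_nf

/-- The derivative of the value function takes the shadow price at time `t` exactly at the
inventory that is sold out after the remaining time. -/
theorem dv_eq_price_iff (hζ : 0 < M.zeta) {τ t y : ℝ} (ht : t ≤ τ) (hy : 0 ≤ y) :
    M.dv y = M.price τ t ↔ y = M.drain (τ - t) := by
  rw [dv_eq hζ hy, price_of_ge ht]
  constructor
  · intro h
    have h1 := Real.exp_injective (mul_left_cancel₀ hζ.ne' h)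
    rw [← mul_left_cancel₀ (neg_ne_zero.2 M.β_pos.ne') h1, drain_symm]
  · rintro rfl
    rw [symm_drain]

/-- The selected maximisers are the derivatives of the conjugates, so controls that follow them
outside a countable set of times are feedback controls. -/
theorem isFeedback_of_regularTimes {F : Set ℝ}
    (hF : ∀ z ∈ F, DifferentiableAt ℝ M.Rhat z ∧ DifferentiableAt ℝ M.Chat z)
    {x : ℝ} {qhat αhat X : ℝ → ℝ} (hq : ∀ z ∈ F, M.optSell z = {qhat z})
    (hα : ∀ z ∈ F, M.optProd z = {αhat z})
    (hX : ∀ t ∈ Icc 0 (M.tau x), M.dv (X t) = M.price (M.tau x) t)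
    (hcount : (Icc 0 (M.tau x) \ M.regularTimes F x X).Countable) {α q : ℝ → ℝ}
    (h : ∀ t ∈ M.regularTimes F x X, α t = αhat (M.dv (X t)) ∧ q t = qhat (M.dv (X t))) :
    M.IsFeedback (M.tau x) (Icc 0 (M.tau x) \ M.regularTimes F x X) α q := by
  have hreg : ∀ t ∈ Icc 0 (M.tau x) \ (Icc 0 (M.tau x) \ M.regularTimes F x X),
      t ∈ M.regularTimes F x X ∧ M.price (M.tau x) t ∈ F := by
    intro t ht
    have hr : t ∈ M.regularTimes F x X := by
      by_contra hn
      exact ht.2 ⟨ht.1, hn⟩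
    refine ⟨hr, ?_⟩
    rw [← hX t ht.1]
    exact hr.2
  refine ⟨hcount, fun t ht => (hF _ (hreg t ht).2).1, fun t ht => (hF _ (hreg t ht).2).2,
    fun t ht => ?_, fun t ht => ?_⟩
  · obtain ⟨hr, hz⟩ := hreg t ht
    rw [(h t hr).1, hX t ht.1]
    exact singleton_injective
      ((hα _ hz).symm.trans (M.optimal_rates (hF _ hz).1 (hF _ hz).2).2.1)
  · obtain ⟨hr, hz⟩ := hreg t ht
    rw [(h t hr).2, hX t ht.1]
    exact singleton_injective
      ((hq _ hz).symm.trans (M.optimal_rates (hF _ hz).1 (hF _ hz).2).1)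

end Firm

theorem theorem6 (M : Firm) (hζ : 0 < M.zeta) :
    -- the objects used below are well defined
    IsLeast M.minPoints M.zeta ∧
    {z | z ∈ Ioo 0 M.zeta ∧
      ¬ (DifferentiableAt ℝ M.Rhat z ∧ DifferentiableAt ℝ M.Chat z)}.Countable ∧
    (∀ y, 0 ≤ y → M.value y ≠ ⊥ ∧ M.value y ≠ ⊤) ∧
    DifferentiableOn ℝ M.v (Ici 0) ∧
    (∀ y, 0 ≤ y → 0 < M.dv y) ∧
    M.optStaticConv.Nonempty ∧
    -- for every co-countable set `F` of points of differentiability and every inventory `x > 0`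
    ∀ F : Set ℝ, F ⊆ Ioo 0 M.zeta → (Ioo 0 M.zeta \ F).Countable →
      (∀ z ∈ F, DifferentiableAt ℝ M.Rhat z ∧ DifferentiableAt ℝ M.Chat z) →
    ∀ x : ℝ, 0 < x →
      -- the feedback controls, the time `τ` and the path `X` are well defined
      (∀ z ∈ F, (∃ y, M.optSell z = {y}) ∧ ∃ y, M.optProd z = {y}) ∧
      0 < M.tau x ∧
      (∀ t ∈ Icc 0 (M.tau x), ∃! y, 0 ≤ y ∧ M.dv y = M.dv x * Real.exp (M.β * t)) ∧
      ∀ qhat αhat X : ℝ → ℝ,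
        (∀ z ∈ F, M.optSell z = {qhat z}) →
        (∀ z ∈ F, M.optProd z = {αhat z}) →
        (∀ t ∈ Icc 0 (M.tau x), 0 ≤ X t ∧ M.dv (X t) = M.dv x * Real.exp (M.β * t)) →
        -- the path decreases strictly from `x` to `0`, and the exceptional times are countable
        StrictAntiOn X (Icc 0 (M.tau x)) ∧ X 0 = x ∧ X (M.tau x) = 0 ∧
        (Icc 0 (M.tau x) \ M.regularTimes F x X).Countable ∧
        -- the feedback controls induce the path `X` on `[0, τ]`
        (∀ α q : ℝ → ℝ,
          (∀ t ∈ M.regularTimes F x X,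
            α t = αhat (M.dv (X t)) ∧ q t = qhat (M.dv (X t))) →
          ∀ t ∈ Icc 0 (M.tau x), inventory x α q t = X t) ∧
        -- (i)
        (∀ u ∈ M.optStaticConv, ∀ α q : ℝ → ℝ,
          (∀ t ∈ M.regularTimes F x X,
            α t = αhat (M.dv (X t)) ∧ q t = qhat (M.dv (X t))) →
          (∀ t ∈ Icc 0 (M.tau x) \ M.regularTimes F x X, α t ∈ M.coA ∧ q t ∈ M.coQ) →
          (∀ t, M.tau x < t → α t = u ∧ q t = u) →
          IsOptimal M.β M.coA M.coQ M.Rtilde M.Ctilde x α q ∧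
          ∀ t, M.tau x ≤ t → inventory x α q t = 0) ∧
        -- (ii)
        (∀ t ∈ M.regularTimes F x X,
          αhat (M.dv (X t)) ∈ M.A ∧ qhat (M.dv (X t)) ∈ M.Q ∧
          M.Ctilde (αhat (M.dv (X t))) = M.C (αhat (M.dv (X t))) ∧
          M.Rtilde (qhat (M.dv (X t))) = M.R (qhat (M.dv (X t)))) ∧
        -- (iii)
        (∀ u ∈ M.optStaticConv,
          (∃ q₁ ∈ M.Q, ∃ q₂ ∈ M.Q, ∃ γ ∈ Ioo (0 : ℝ) 1,
            u = γ * q₁ + (1 - γ) * q₂ ∧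
            M.Rtilde u = γ * M.R q₁ + (1 - γ) * M.R q₂) ∧
          (∃ α₁ ∈ M.A, ∃ α₂ ∈ M.A, ∃ ν ∈ Ioo (0 : ℝ) 1,
            u = ν * α₁ + (1 - ν) * α₂ ∧
            M.Ctilde u = ν * M.C α₁ + (1 - ν) * M.C α₂) ∧
          ∀ q₁ ∈ M.Q, ∀ q₂ ∈ M.Q, ∀ α₁ ∈ M.A, ∀ α₂ ∈ M.A,
          ∀ γ ∈ Ioo (0 : ℝ) 1, ∀ ν ∈ Ioo (0 : ℝ) 1,
            u = γ * q₁ + (1 - γ) * q₂ →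
            u = ν * α₁ + (1 - ν) * α₂ →
            M.Rtilde u = γ * M.R q₁ + (1 - γ) * M.R q₂ →
            M.Ctilde u = ν * M.C α₁ + (1 - ν) * M.C α₂ →
            ∀ α q : ℝ → Measure ℝ,
              (∀ t ∈ M.regularTimes F x X,
                α t = Measure.dirac (αhat (M.dv (X t))) ∧
                q t = Measure.dirac (qhat (M.dv (X t)))) →
              (∀ t ∈ Icc 0 (M.tau x) \ M.regularTimes F x X,
                IsProbOn M.A (α t) ∧ IsProbOn M.Q (q t)) →
              (∀ t, M.tau x < t → α t = twoPoint ν α₁ α₂ ∧ q t = twoPoint γ q₁ q₂) →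
              IsRelaxedOptimal M.β M.A M.Q M.R M.C x α q) ∧
        -- (iv)
        ((M.sharedOpt M.zeta).Nonempty →
          M.optStatic.Nonempty ∧
          ∀ u ∈ M.optStatic, ∀ α q : ℝ → ℝ,
            (∀ t ∈ M.regularTimes F x X,
              α t = αhat (M.dv (X t)) ∧ q t = qhat (M.dv (X t))) →
            (∀ t ∈ Icc 0 (M.tau x) \ M.regularTimes F x X, α t ∈ M.A ∧ q t ∈ M.Q) →
            (∀ t, M.tau x < t → α t = u ∧ q t = u) →
            IsOptimal M.β M.A M.Q M.R M.C x α q) := by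
  refine ⟨M.isLeast_minPoints, M.countable_not_differentiableAt.mono fun z hz => hz.2, ?_, ?_, ?_,
    M.optStaticConv_nonempty, ?_⟩
  · intro y hy
    rw [Firm.value_eq hζ hy]
    exact ⟨EReal.coe_ne_bot _, EReal.coe_ne_top _⟩
  · exact fun y hy => (Firm.hasDerivWithinAt_v hζ hy).differentiableWithinAt
  · intro y hy
    rw [Firm.dv_eq hζ hy]
    exact mul_pos hζ (Real.exp_pos _)
  intro F hFsub hFc hF x hx
  have hτ := Firm.tau_pos hζ hx
  have hdrain := Firm.drain_tau hζ hx.le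
  refine ⟨fun z hz => ⟨⟨_, (M.optimal_rates (hF z hz).1 (hF z hz).2).1⟩,
    ⟨_, (M.optimal_rates (hF z hz).1 (hF z hz).2).2.1⟩⟩, hτ, ?_, ?_⟩
  · intro t ht
    rw [Firm.dv_mul_exp hζ hx.le ht.2]
    have h0 := Firm.drain_nonneg hζ (sub_nonneg.2 ht.2)
    exact ⟨M.drain (M.tau x - t), ⟨h0, (Firm.dv_eq_price_iff hζ ht.2 h0).2 rfl⟩,
      fun y hy => (Firm.dv_eq_price_iff hζ ht.2 hy.1).1 hy.2⟩
  intro qhat αhat X hq hα hX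
  have hXp : ∀ t ∈ Icc 0 (M.tau x), M.dv (X t) = M.price (M.tau x) t := fun t ht =>
    (hX t ht).2.trans (Firm.dv_mul_exp hζ hx.le ht.2)
  have hXd : ∀ t ∈ Icc 0 (M.tau x), X t = M.drain (M.tau x - t) := fun t ht =>
    (Firm.dv_eq_price_iff hζ ht.2 (hX t ht).1).1 (hXp t ht)
  have hcount : (Icc 0 (M.tau x) \ M.regularTimes F x X).Countable := by
    refine ((Firm.countable_price_mem hζ (M.tau x) hFc).union
      (countable_singleton (M.tau x))).mono ?_
    intro t ht
    rcases eq_or_lt_of_le ht.1.2 with h | h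
    · exact Or.inr h
    · refine Or.inl ⟨h.le, ⟨Firm.price_pos hζ _ _, Firm.price_lt hζ h⟩, fun hz => ht.2 ⟨ht.1, ?_⟩⟩
      rwa [hXp t ht.1]
  have hfb : ∀ {α q : ℝ → ℝ}, (∀ t ∈ M.regularTimes F x X,
      α t = αhat (M.dv (X t)) ∧ q t = qhat (M.dv (X t))) →
      M.IsFeedback (M.tau x) (Icc 0 (M.tau x) \ M.regularTimes F x X) α q :=
    fun h => Firm.isFeedback_of_regularTimes hF hq hα hXp hcount h
  have hinter : ∀ {t : ℝ}, t ∈ Icc 0 (M.tau x) ∩ (Icc 0 (M.tau x) \ M.regularTimes F x X) →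
      t ∈ Icc 0 (M.tau x) \ M.regularTimes F x X := fun h => h.2
  refine ⟨?_, ?_, ?_, hcount, ?_, ?_, ?_, ?_, ?_⟩
  · intro s hs t ht hst
    rw [hXd s hs, hXd t ht]
    exact Firm.strictMono_drain hζ (by linarith)
  · rw [hXd 0 ⟨le_rfl, hτ.le⟩, sub_zero, hdrain]
  · rw [hXd _ ⟨hτ.le, le_rfl⟩, sub_self, Firm.drain_zero]
  · intro α q h t ht
    rw [hXd t ht, ← (hfb h).inventory_eq hζ ht, hdrain]
  · intro u hu α q h hS hend
    obtain ⟨huQ, huA, huR, huC⟩ := M.optStaticConv_tight hu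
    have hopt := (hfb h).isOptimal M.isDominated_convexified hζ hτ.le
      (fun z hR hC => by
        obtain ⟨-, -, h3, h4, h5, h6, h7, h8, -⟩ := M.optimal_rates hR hC
        exact ⟨M.A_subset_coA h4, M.Q_subset_coQ h3, h8.trans h6, h7.trans h5⟩)
      (fun t ht => hS t (hinter ht)) huA huQ huC huR hend
    rwa [hdrain] at hopt
  · intro t ht
    obtain ⟨h1, h2, h3, h4, -, -, h7, h8, -⟩ := M.optimal_rates (hF _ ht.2).1 (hF _ ht.2).2
    rw [singleton_injective ((hα _ ht.2).symm.trans h2),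
      singleton_injective ((hq _ ht.2).symm.trans h1)]
    exact ⟨h4, h3, h8, h7⟩
  · intro u hu
    obtain ⟨huQ, huA, huR, huC⟩ := M.optStaticConv_tight hu
    refine ⟨?_, ?_, ?_⟩
    · obtain ⟨q₁, hq₁, q₂, hq₂, γ, hγ, -, h1, h2, h3⟩ := M.exists_sell_combo hu
      refine ⟨q₁, hq₁, q₂, hq₂, γ, hγ, h3, ?_⟩
      rw [huR, h1, h2, h3]
      ring
    · obtain ⟨a₁, ha₁, a₂, ha₂, ν, hν, -, h1, h2, h3⟩ := M.exists_prod_combo hu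
      refine ⟨a₁, ha₁, a₂, ha₂, ν, hν, h3, ?_⟩
      rw [huC, h1, h2, h3]
      ring
    intro q₁ hq₁ q₂ hq₂ a₁ ha₁ a₂ ha₂ γ hγ ν hν huq hua hRu hCu α q h hS hend
    have hmain := Firm.isRelaxedOptimal_of_feedback hζ hτ.le (u := u)
      (hfb (α := fun t => αhat (M.dv (X t))) (q := fun t => qhat (M.dv (X t)))
        fun _ _ => ⟨rfl, rfl⟩)
      (α := α) (q := q)
      (fun t ht => (h t (by by_contra hn; exact ht.2 ⟨ht.1, hn⟩)).1)
      (fun t ht => (h t (by by_contra hn; exact ht.2 ⟨ht.1, hn⟩)).2)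
      (fun t ht => hS t (hinter ht))
      (isProbOn_twoPoint hν ha₁ ha₂) (isProbOn_twoPoint hγ hq₁ hq₂)
      ((integral_twoPoint hν fun y => y).trans hua.symm)
      ((integral_twoPoint hγ fun y => y).trans huq.symm)
      (by rw [lintegral_ofReal_twoPoint hν (M.C_nonneg _ ha₁) (M.C_nonneg _ ha₂), ← hCu, huC])
      (by rw [lintegral_ofReal_twoPoint hγ (M.R_nonneg _ hq₁) (M.R_nonneg _ hq₂), ← hRu, huR])
      (by rw [lintegral_ofReal_twoPoint (f := fun y => y) hν (M.A_nonneg _ ha₁)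
            (M.A_nonneg _ ha₂)]
          exact ENNReal.ofReal_lt_top)
      (by rw [← huC]; exact M.Ctilde_nonneg u)
      hend
    rwa [hdrain] at hmain
  · intro hshared
    refine ⟨M.optStatic_nonempty hshared, fun u hu α q h hS hend => ?_⟩
    obtain ⟨huQ, huA, huR, huC⟩ := M.optStatic_tight hshared hu
    have hopt := (hfb h).isOptimal M.isDominated_self hζ hτ.le
      (fun z hR hC => by
        obtain ⟨-, -, h3, h4, h5, h6, -⟩ := M.optimal_rates hR hC
        exact ⟨h4, h3, h6, h5⟩)
      (fun t ht => hS t (hinter ht)) huA huQ huC huR hend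
    rw [hdrain] at hopt
    exact hopt.1
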